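/- **Conventions.** Let $n\ge 0$ be an integer. $\dim$ is the (Lebesgue) covering dimension. An inclusion $A\hookrightarrow B$ of spaces is *trivial in $\pi_i$* if every continuous map $S^i\to A$ is nullhomotopic as a map to $B$. A space $X$ is *$LC^n$* (locally $n$-connected) if for every $x\in X$ and every open neighborhood $\mathcal U$ of $x$ there is an open neighborhood $\mathcal V\subseteq\mathcal U$ of $x$ such that $\mathcal V\hookrightarrow\mathcal U$ is trivial in $\pi_i$ for all $0\le i\le n$. A nowhere dense closed subset $Z\subseteq X$ is *$LCC^n$* in $X$ (locally complementarily $n$-connected) if for every $z\in Z$ and every open neighborhood $\mathcal U$ of $z$ in $X$ there is an open neighborhood $\mathcal V\subseteq\mathcal U$ of $z$ in $X$ such that $\mathcal V\setminus Z\hookrightarrow\mathcal U\setminus Z$ is trivial in $\pi_i$ for all $0\le i\le n$. A nowhere dense closed subset $Z\subseteq X$ is a *Z-set* in $X$ if there is a continuous map $H:X\times[0,1]\to X$ with $H(x,0)=x$ for all $x\in X$ and $H(X\times(0,1])\subseteq X\setminus Z$. A compact metrizable space $X$ is an *AR* (resp. *ANR*) if, whenever $X$ is embedded as a closed subset of a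 compact metrizable space $Y$, it is a retract of $Y$ (resp. of some open neighborhood of $X$ in $Y$). **Theorem.** Let $X$ be a compact metrizable space with $\dim X\le n$, and let $Z\subset X$ be a nowhere dense closed subset which is $LCC^n$ in $X$ and such that $X\setminus Z$ is $LC^n$. Then $X$ is an ANR and $Z$ is a Z-set in $X$. If in addition $X\setminus Z$ is contractible, then $X$ is an AR. -/

import Mathlib

open Set Topology TopologicalSpace

/-- The Lebesgue covering dimension of `X` is at most `n`: every finite open cover of `X` has a
finite open refinement covering `X`, no point of `X` lying in more than `n + 1` of its members. -/
def CoveringDimLE (n : ℕ) (X : Type*) [TopologicalSpace X] : Prop :=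
  ∀ U : Set (Set X), U.Finite → (∀ u ∈ U, IsOpen u) → ⋃₀ U = univ →
    ∃ V : Set (Set X), V.Finite ∧ (∀ v ∈ V, IsOpen v) ∧ ⋃₀ V = univ ∧
      (∀ v ∈ V, ∃ u ∈ U, v ⊆ u) ∧ ∀ x : X, {v ∈ V | x ∈ v}.encard ≤ (n : ℕ∞) + 1

/-- The inclusion of `A` in `B` is trivial in `π_i` for all `0 ≤ i ≤ n`: every continuous map from
the sphere `S^i` to `A` is nullhomotopic as a map to `B`. -/
def InclusionTrivialPi {X : Type*} [TopologicalSpace X] (n : ℕ) {A B : Set X} (h : A ⊆ B) : Prop :=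
  ∀ i : ℕ, i ≤ n → ∀ f : C(Metric.sphere (0 : EuclideanSpace ℝ (Fin (i + 1))) 1, A),
    ((ContinuousMap.inclusion h).comp f).Nullhomotopic

/-- `X` is locally `n`-connected (`LC^n`). -/
def IsLC (n : ℕ) (X : Type*) [TopologicalSpace X] : Prop :=
  ∀ x : X, ∀ U : Set X, IsOpen U → x ∈ U →
    ∃ V : Set X, IsOpen V ∧ x ∈ V ∧ ∃ h : V ⊆ U, InclusionTrivialPi n h

/-- `Z` is locally complementarily `n`-connected (`LCC^n`) in `X`. -/
def IsLCC {X : Type*} [TopologicalSpace X] (n : ℕ) (Z : Set X) : Prop :=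
  ∀ z ∈ Z, ∀ U : Set X, IsOpen U → z ∈ U →
    ∃ V : Set X, IsOpen V ∧ z ∈ V ∧ ∃ h : V ⊆ U,
      InclusionTrivialPi n (sdiff_subset_sdiff_left h : V \ Z ⊆ U \ Z)

/-- `Z` is a Z-set in `X`: it is closed and nowhere dense, and `X` can be instantaneously homotoped
off `Z`. -/
def IsZSet {X : Type*} [TopologicalSpace X] (Z : Set X) : Prop :=
  IsClosed Z ∧ IsNowhereDense Z ∧
    ∃ H : C(X × unitInterval, X), (∀ x : X, H (x, 0) = x) ∧
      ∀ (x : X) (t : unitInterval), 0 < t → H (x, t) ∉ Z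

universe u

/-- A (compact metrizable) space `X` is an absolute neighborhood retract: whenever `X` is embedded
as a closed subset of a compact metrizable space `Y`, some open neighborhood of it in `Y`
retracts onto it. -/
def IsANR (X : Type u) [TopologicalSpace X] : Prop :=
  ∀ (Y : Type u) [TopologicalSpace Y] [CompactSpace Y] [MetrizableSpace Y] (e : X → Y),
    IsClosedEmbedding e →
      ∃ O : Set Y, IsOpen O ∧ range e ⊆ O ∧
        ∃ r : C(O, X), ∀ (x : X) (hx : e x ∈ O), r ⟨e x, hx⟩ = x

/-- A (compact metrizable) space `X` is an absolute retract: whenever `X` is embedded as a closed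
subset of a compact metrizable space `Y`, the space `Y` retracts onto it. -/
def IsAR (X : Type u) [TopologicalSpace X] : Prop :=
  ∀ (Y : Type u) [TopologicalSpace Y] [CompactSpace Y] [MetrizableSpace Y] (e : X → Y),
    IsClosedEmbedding e → ∃ r : C(Y, X), ∀ x : X, r (e x) = x

/-! Write W for the complement of Z. The heart of the matter is a neighbourhood retraction with a
side condition: if X sits as a closed subset of Y, some neighbourhood of X retracts onto X by a map
sending every point off X into W (`exists_retraction_into`). For arbitrary Y this gives the ANR
property. For Y = X × [0,1], with X at height 0, following the retraction up the interval pushes X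
off Z. If W is contractible, the end of that push factors the identity of X, up to homotopy, through
W; so X is contractible, and a contractible ANR is an AR.

To build the retraction, compactness first turns LCC^n at points of Z and LC^n of W into one uniform
statement: small spheres of dimension at most n in W bound in slightly larger balls of W, even
around points of Z (`uniformlyLC_compl`). The covering dimension supplies ever finer covers of order
at most n + 1, each refining the one before. Their nerves, joined by simplicial mapping cylinders,
form a telescope of dimension at most n + 1. Vertices are sent to points of W in the corresponding
cover members (W is dense), and the map is extended over the skeleta; only spheres of dimension at
most n have to be filled, and simplices of high level have small images (`exists_realization`,
`exists_covers_realization`).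

Near X in Y, partitions of unity map a punctured neighbourhood of X to the telescope, the level
tending to infinity at X (`bridge`, `exists_simplexFace_bridge`). Composing with the realization
gives a map to W that stays close to a nearest point of X, hence extends continuously by the
identity of X. -/

/-! ### Simplices and the filling of their boundaries -/

/-- The face spanned by `σ` of the full simplex on the vertex set `ι`, in barycentric coordinates. -/
def simplexFace {ι : Type*} (σ : Finset ι) : Set (ι → ℝ) :=
  {x | (∀ i, 0 ≤ x i) ∧ (∀ i ∉ σ, x i = 0) ∧ ∑ i ∈ σ, x i = 1}

/-- The boundary of `simplexFace σ`. -/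
def simplexFaceBoundary {ι : Type*} (σ : Finset ι) : Set (ι → ℝ) :=
  {x | x ∈ simplexFace σ ∧ ∃ i ∈ σ, x i = 0}

/-- The unit sphere of dimension `m`. -/
abbrev UnitSphere (m : ℕ) : Type :=
  Metric.sphere (0 : EuclideanSpace ℝ (Fin (m + 1))) 1

/-- Every map of the `m`-sphere into `A` is nullhomotopic in `B`. -/
def SphereNullIn {X : Type*} [TopologicalSpace X] (m : ℕ) (A B : Set X) : Prop :=
  ∀ f : C(UnitSphere m, X), (∀ u, f u ∈ A) →
    ∃ (c : X) (H : C(UnitSphere m × unitInterval, X)),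
      (∀ u, H (u, 0) = f u) ∧ (∀ u, H (u, 1) = c) ∧ ∀ q, H q ∈ B

theorem isClosed_simplexFace {ι : Type*} (σ : Finset ι) : IsClosed (simplexFace σ) := by
  have h : simplexFace σ = (⋂ i, {x : ι → ℝ | 0 ≤ x i}) ∩
      ((⋂ i, ⋂ _ : i ∉ σ, {x : ι → ℝ | x i = 0}) ∩ {x | ∑ i ∈ σ, x i = 1}) := by
    ext x
    simp [simplexFace]
  rw [h]
  refine IsClosed.inter ?_ (IsClosed.inter ?_ ?_)
  · exact isClosed_iInter fun i => isClosed_le continuous_const (continuous_apply i)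
  · exact isClosed_iInter fun i => isClosed_iInter fun _ =>
      isClosed_eq (continuous_apply i) continuous_const
  · exact isClosed_eq (by fun_prop) continuous_const

/-- The largest of the numbers `-v j`. -/
noncomputable def maxNeg {m : ℕ} (v : Fin (m + 1) → ℝ) : ℝ :=
  Finset.univ.sup' Finset.univ_nonempty fun j => -v j

theorem neg_le_maxNeg {m : ℕ} (v : Fin (m + 1) → ℝ) (j : Fin (m + 1)) : -v j ≤ maxNeg v :=
  Finset.le_sup' (fun j => -v j) (Finset.mem_univ j)

theorem exists_maxNeg_eq {m : ℕ} (v : Fin (m + 1) → ℝ) : ∃ j, maxNeg v = -v j := by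
  obtain ⟨j, -, h⟩ := Finset.exists_mem_eq_sup' (s := Finset.univ) Finset.univ_nonempty
    (fun j => -v j)
  exact ⟨j, h⟩

theorem continuous_maxNeg {m : ℕ} : Continuous (maxNeg : (Fin (m + 1) → ℝ) → ℝ) := by
  unfold maxNeg
  exact Continuous.finset_sup'_apply _ fun j _ => (continuous_apply j).neg

theorem maxNeg_pos {m : ℕ} {v : Fin (m + 1) → ℝ} (hs : ∑ j, v j = 0) (hv : v ≠ 0) :
    0 < maxNeg v := by
  by_contra! h
  apply hv
  have h0 : ∀ j ∈ Finset.univ, 0 ≤ v j := fun j _ => by linarith [neg_le_maxNeg v j]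
  funext j
  exact (Finset.sum_eq_zero_iff_of_nonneg h0).1 hs j (Finset.mem_univ j)

theorem maxNeg_smul {m : ℕ} (v : Fin (m + 1) → ℝ) {c : ℝ} (hc : 0 ≤ c) :
    maxNeg (c • v) = c * maxNeg v := by
  obtain ⟨j, hj⟩ := exists_maxNeg_eq v
  obtain ⟨k, hk⟩ := exists_maxNeg_eq (c • v)
  apply le_antisymm
  · rw [hk]
    have := mul_le_mul_of_nonneg_left (neg_le_maxNeg v k) hc
    simpa using this
  · rw [hj]
    have := neg_le_maxNeg (c • v) j
    simpa using this

/-- The vector of coordinate sum zero whose coordinates after the first are those of `u`. -/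
def zeroSumLift {m : ℕ} (u : EuclideanSpace ℝ (Fin (m + 1))) : Fin (m + 2) → ℝ :=
  Fin.cons (-∑ j, u j) fun j => u j

theorem sum_zeroSumLift {m : ℕ} (u : EuclideanSpace ℝ (Fin (m + 1))) :
    ∑ j, zeroSumLift u j = 0 := by
  simp [zeroSumLift, Fin.sum_univ_succ (n := m + 1)]

theorem zeroSumLift_smul {m : ℕ} (c : ℝ) (u : EuclideanSpace ℝ (Fin (m + 1))) :
    zeroSumLift (c • u) = c • zeroSumLift u := by
  funext j
  refine Fin.cases ?_ (fun j => ?_) j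
  · simp [zeroSumLift, Finset.mul_sum]
  · simp [zeroSumLift]

theorem zeroSumLift_ne_zero {m : ℕ} {u : EuclideanSpace ℝ (Fin (m + 1))} (hu : u ≠ 0) :
    zeroSumLift u ≠ 0 := by
  intro h
  apply hu
  ext j
  have := congrFun h j.succ
  simpa [zeroSumLift] using this

theorem continuous_zeroSumLift {m : ℕ} :
    Continuous (zeroSumLift : EuclideanSpace ℝ (Fin (m + 1)) → Fin (m + 2) → ℝ) := by
  refine continuous_pi fun j => ?_
  refine Fin.cases ?_ (fun j => ?_) j
  · simp only [zeroSumLift, Fin.cons_zero]; fun_prop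
  · simp only [zeroSumLift, Fin.cons_succ]; fun_prop

/-- Radial projection to the unit sphere. -/
noncomputable def toSphere {m : ℕ} (u : EuclideanSpace ℝ (Fin (m + 1))) (hu : u ≠ 0) :
    UnitSphere m :=
  ⟨‖u‖⁻¹ • u, by
    rw [mem_sphere_zero_iff_norm, norm_smul, norm_inv, norm_norm,
      inv_mul_cancel₀ (norm_ne_zero_iff.2 hu)]⟩

/-- The simplex is a cone over its boundary, and the boundary is an m-sphere by radial projection
from the barycentre. A nullhomotopy of the boundary map, run inwards along the radii, is therefore
an extension over the simplex. -/
theorem exists_extension_simplexFace {ι X : Type*} [TopologicalSpace X] {m : ℕ} {A B : Set X}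
    (hAB : SphereNullIn m A B) {σ : Finset ι} (hσ : σ.card = m + 2) {g : (ι → ℝ) → X}
    (hg : ContinuousOn g (simplexFaceBoundary σ)) (hgA : ∀ x ∈ simplexFaceBoundary σ, g x ∈ A) :
    ∃ G : (ι → ℝ) → X, ContinuousOn G (simplexFace σ) ∧
      (∀ x ∈ simplexFaceBoundary σ, G x = g x) ∧ ∀ x ∈ simplexFace σ, G x ∈ B := by
  classical
  let a : Fin (m + 2) ≃ σ := (Finset.equivFinOfCardEq hσ).symm
  set N : ℝ := (m : ℝ) + 2 with hN
  have hN0 : 0 < N := by positivity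
  have hsum : ∀ f : ι → ℝ, ∑ i ∈ σ, f i = ∑ j, f (a j) := fun f => by
    rw [← Finset.sum_coe_sort σ f, ← a.sum_comp]
  -- the radial parametrization of the boundary
  let pt : EuclideanSpace ℝ (Fin (m + 1)) → ι → ℝ := fun u i =>
    if h : i ∈ σ then
      1 / N + zeroSumLift u (a.symm ⟨i, h⟩) / (N * maxNeg (zeroSumLift u)) else 0
  have hpta : ∀ u j, pt u (a j) = 1 / N + zeroSumLift u j / (N * maxNeg (zeroSumLift u)) := by
    intro u j
    simp [pt]
  have hpos : ∀ u : EuclideanSpace ℝ (Fin (m + 1)), u ≠ 0 → 0 < maxNeg (zeroSumLift u) :=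
    fun u hu => maxNeg_pos (sum_zeroSumLift u) (zeroSumLift_ne_zero hu)
  have hptb : ∀ u : EuclideanSpace ℝ (Fin (m + 1)), u ≠ 0 → pt u ∈ simplexFaceBoundary σ := by
    intro u hu
    have h0 := hpos u hu
    refine ⟨⟨fun i => ?_, fun i hi => by simp [pt, hi], ?_⟩, ?_⟩
    · by_cases h : i ∈ σ
      · obtain ⟨j, hj⟩ := a.surjective ⟨i, h⟩
        have hij : i = a j := by rw [hj]
        rw [hij, hpta, mul_comm N, ← div_div, ← add_div]
        refine div_nonneg ?_ hN0.le
        have := neg_le_maxNeg (zeroSumLift u) j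
        have h2 : -1 ≤ zeroSumLift u j / maxNeg (zeroSumLift u) := by
          rw [le_div_iff₀ h0]; linarith
        linarith
      · simp [pt, h]
    · rw [hsum]
      simp_rw [hpta]
      rw [Finset.sum_add_distrib, ← Finset.sum_div, ← Finset.sum_div, sum_zeroSumLift]
      simp [hN]
      positivity
    · obtain ⟨j, hj⟩ := exists_maxNeg_eq (zeroSumLift u)
      refine ⟨a j, (a j).2, ?_⟩
      rw [hpta]
      have h3 : zeroSumLift u j = -maxNeg (zeroSumLift u) := by linarith
      rw [h3]
      field_simp
      ring
  have hptc : Continuous fun u : UnitSphere m => pt u := by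
    refine continuous_pi fun i => ?_
    by_cases h : i ∈ σ
    · simp only [pt, h, dite_true]
      refine continuous_const.add (Continuous.div ?_ ?_ ?_)
      · exact (continuous_apply _).comp (continuous_zeroSumLift.comp continuous_subtype_val)
      · exact continuous_const.mul
          (continuous_maxNeg.comp (continuous_zeroSumLift.comp continuous_subtype_val))
      · intro u
        have : (u : EuclideanSpace ℝ (Fin (m + 1))) ≠ 0 := ne_zero_of_mem_unit_sphere u
        exact (mul_pos hN0 (hpos _ this)).ne'
    · simp only [pt, h, dite_false]
      exact continuous_const
  -- Invariance under scaling makes normalization to the unit sphere harmless when `pt` is compared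
  -- with its inverse.
  have hpts : ∀ (c : ℝ), 0 < c → ∀ u, pt (c • u) = pt u := by
    intro c hc u
    funext i
    by_cases h : i ∈ σ
    · simp only [pt, h, dite_true, zeroSumLift_smul, maxNeg_smul _ hc.le, Pi.smul_apply,
        smul_eq_mul]
      rw [mul_left_comm N, mul_div_mul_left _ _ hc.ne']
    · simp [pt, h]
  -- the inverse of the parametrization
  let dv : (ι → ℝ) → Fin (m + 2) → ℝ := fun x j => x (a j) - 1 / N
  let bk : (ι → ℝ) → EuclideanSpace ℝ (Fin (m + 1)) := fun x =>
    WithLp.toLp 2 fun j => dv x j.succ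
  -- This is 1 minus N times the least coordinate on σ: a gauge equal to 0 at the barycentre and 1
  -- on the boundary.
  let γ : (ι → ℝ) → ℝ := fun x => N * maxNeg (dv x)
  have hdvc : Continuous dv := by fun_prop
  have hbkc : Continuous bk := by fun_prop
  have hγc : Continuous γ := continuous_const.mul (continuous_maxNeg.comp hdvc)
  have hlift : ∀ x ∈ simplexFace σ, zeroSumLift (bk x) = dv x := by
    intro x hx
    have h1 : ∑ j, dv x j = 0 := by
      simp only [dv, Finset.sum_sub_distrib, ← hsum, hx.2.2]
      simp [hN]
      field_simp
      ring
    funext j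
    refine Fin.cases ?_ (fun j => ?_) j
    · rw [Fin.sum_univ_succ] at h1
      simp only [zeroSumLift, Fin.cons_zero, bk]
      linarith
    · simp [zeroSumLift, bk]
  have hγ1 : ∀ x ∈ simplexFace σ, γ x ≤ 1 := by
    intro x hx
    obtain ⟨j, hj⟩ := exists_maxNeg_eq (dv x)
    simp only [γ, hj, dv]
    have := hx.1 (a j)
    have h2 : N * -(x (a j) - 1 / N) = 1 - N * x (a j) := by field_simp; ring
    rw [h2]
    nlinarith
  have hγb : ∀ x ∈ simplexFaceBoundary σ, γ x = 1 := by
    rintro x ⟨hx, i, hi, hxi⟩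
    refine le_antisymm (hγ1 x hx) ?_
    obtain ⟨j, hj⟩ := a.surjective ⟨i, hi⟩
    have h1 := neg_le_maxNeg (dv x) j
    have h2 : dv x j = -(1 / N) := by simp [dv, hj, hxi]
    rw [h2] at h1
    have h3 := mul_le_mul_of_nonneg_left h1 hN0.le
    have h4 : N * - -(1 / N) = 1 := by field_simp
    linarith
  have hbk0 : ∀ x ∈ simplexFace σ, γ x ≠ 0 → bk x ≠ 0 := by
    intro x hx hγ h
    apply hγ
    have h1 := hlift x hx
    rw [h] at h1
    have h2 : zeroSumLift (0 : EuclideanSpace ℝ (Fin (m + 1))) = 0 := by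
      have := zeroSumLift_smul (m := m) 0 0
      simpa using this
    simp only [γ, ← h1, h2]
    have := maxNeg_smul (0 : Fin (m + 2) → ℝ) (le_refl (0 : ℝ))
    simp at this
    simp [this]
  have hptbk : ∀ x ∈ simplexFaceBoundary σ, pt (bk x) = x := by
    intro x hx
    have h1 := hγb x hx
    funext i
    by_cases h : i ∈ σ
    · obtain ⟨j, hj⟩ := a.surjective ⟨i, h⟩
      have hij : i = a j := by rw [hj]
      rw [hij, hpta, hlift x hx.1]
      change _ + _ / γ x = _
      rw [h1]
      simp [dv]
    · rw [hx.1.2.1 i h]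
      simp [pt, h]
  -- the extension
  let f : C(UnitSphere m, X) := ⟨fun u => g (pt u),
    hg.comp_continuous hptc fun u => hptb _ (ne_zero_of_mem_unit_sphere u)⟩
  obtain ⟨c, H, hH0, hH1, hHB⟩ := hAB f fun u => hgA _ (hptb _ (ne_zero_of_mem_unit_sphere u))
  -- Homotopy time runs from 0 at γ = 1 to 1 at γ = 1/2. The inner half of the simplex will be sent
  -- to c, so no continuity check is needed at the barycentre, where the direction `bk x` vanishes.
  let K : (ι → ℝ) → X := fun x => if h : bk x ≠ 0 then
    H (toSphere (bk x) h, projIcc 0 1 zero_le_one (2 - 2 * γ x)) else c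
  have hK1 : ∀ x, bk x ≠ 0 → γ x = 1 / 2 → K x = c := by
    intro x h hx
    have : projIcc (0 : ℝ) 1 zero_le_one (2 - 2 * γ x) = 1 := by
      rw [hx]; exact projIcc_of_right_le _ (by norm_num)
    simp only [K, h, dite_true, this, hH1, ne_eq, not_false_eq_true]
  have hKc : ContinuousOn K {x | bk x ≠ 0} := by
    rw [continuousOn_iff_continuous_domRestrict]
    have h1 : Continuous fun x : {x | bk x ≠ 0} => H (toSphere (bk x) x.2,
        projIcc 0 1 zero_le_one (2 - 2 * γ x)) := by
      refine H.continuous.comp (Continuous.prodMk ?_ ?_)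
      · refine Continuous.subtype_mk ?_ _
        refine Continuous.smul (Continuous.inv₀ ?_ fun x => norm_ne_zero_iff.2 x.2) ?_ <;> fun_prop
      · exact continuous_projIcc.comp (by fun_prop)
    refine h1.congr fun x => ?_
    have := x.2
    simp only [mem_ofPred_eq] at this
    simp [K, this]
  have hcB : c ∈ B := by
    obtain ⟨u, hu⟩ := (NormedSpace.sphere_nonempty (x := (0 : EuclideanSpace ℝ (Fin (m + 1))))
      (r := 1)).2 zero_le_one
    rw [← hH1 ⟨u, hu⟩]
    exact hHB _
  refine ⟨fun x => if γ x ≤ 1 / 2 then c else K x, ?_, ?_, ?_⟩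
  · have hcov : simplexFace σ = (simplexFace σ ∩ {x | γ x ≤ 1 / 2}) ∪
        (simplexFace σ ∩ {x | 1 / 2 ≤ γ x}) := by
      ext x
      constructor
      · intro hx
        rcases le_total (γ x) (1 / 2) with h | h
        · exact Or.inl ⟨hx, h⟩
        · exact Or.inr ⟨hx, h⟩
      · rintro (h | h) <;> exact h.1
    rw [hcov]
    refine ContinuousOn.union_of_isClosed ?_ ?_ ?_ ?_
    · exact continuousOn_const.congr fun x hx => if_pos hx.2
    · refine (hKc.mono ?_).congr ?_
      · rintro x ⟨hx, h⟩
        simp only [mem_ofPred_eq] at h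
        exact hbk0 x hx (by linarith)
      · rintro x ⟨hx, h⟩
        simp only [mem_ofPred_eq] at h
        by_cases h2 : γ x ≤ 1 / 2
        · simp only [h2, if_true]
          exact (hK1 x (hbk0 x hx (by linarith)) (le_antisymm h2 h)).symm
        · simp only [h2, if_false]
    · exact (isClosed_simplexFace σ).inter (isClosed_le hγc continuous_const)
    · exact (isClosed_simplexFace σ).inter (isClosed_le continuous_const hγc)
  · intro x hx
    have h1 := hγb x hx
    have hb := hbk0 x hx.1 (by rw [h1]; exact one_ne_zero)
    have h2 : ¬ γ x ≤ 1 / 2 := by rw [h1]; norm_num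
    have h3 : projIcc (0 : ℝ) 1 zero_le_one (2 - 2 * γ x) = 0 := by
      rw [h1]; exact projIcc_of_le_left _ (by norm_num)
    simp only [h2, if_false, K, hb, dite_true, ne_eq, not_false_eq_true, h3, hH0]
    change g (pt (‖bk x‖⁻¹ • bk x)) = g x
    rw [hpts _ (inv_pos.2 (norm_pos_iff.2 hb)), hptbk x hx]
  · intro x hx
    by_cases h : γ x ≤ 1 / 2
    · simp only [h, if_true, hcB]
    · have hb := hbk0 x hx (by linarith)
      simp only [h, if_false, K, hb, dite_true, ne_eq, not_false_eq_true]
      exact hHB _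

/-! ### Realizing a complex skeleton by skeleton -/

theorem simplexFace_mono {ι : Type*} {τ σ : Finset ι} (h : τ ⊆ σ) :
    simplexFace τ ⊆ simplexFace σ := fun x hx =>
  ⟨hx.1, fun i hi => hx.2.1 i fun h' => hi (h h'), by
    rw [← hx.2.2]
    exact (Finset.sum_subset h fun i _ hi => hx.2.1 i hi).symm⟩

theorem mem_simplexFace_erase {ι : Type*} [DecidableEq ι] {σ : Finset ι} {x : ι → ℝ} {i : ι}
    (hx : x ∈ simplexFace σ) (hi : x i = 0) : x ∈ simplexFace (σ.erase i) := by
  refine ⟨hx.1, fun j hj => ?_, ?_⟩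
  · by_cases hji : j = i
    · rw [hji, hi]
    · exact hx.2.1 j fun h => hj (Finset.mem_erase.2 ⟨hji, h⟩)
  · rw [← hx.2.2]
    exact Finset.sum_erase _ hi

theorem simplexFaceBoundary_eq_biUnion {ι : Type*} [DecidableEq ι] (σ : Finset ι) :
    simplexFaceBoundary σ = ⋃ i ∈ σ, simplexFace (σ.erase i) := by
  ext x
  simp only [mem_iUnion, exists_prop]
  constructor
  · rintro ⟨hx, i, hi, h⟩
    exact ⟨i, hi, mem_simplexFace_erase hx h⟩
  · rintro ⟨i, hi, h⟩
    exact ⟨simplexFace_mono (Finset.erase_subset i σ) h, i, hi,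
      h.2.1 i (Finset.notMem_erase i σ)⟩

theorem continuousOn_biUnion_of_isClosed {α β ι : Type*} [TopologicalSpace α] [TopologicalSpace β]
    [DecidableEq ι] {f : α → β} {s : ι → Set α} (t : Finset ι)
    (hf : ∀ i ∈ t, ContinuousOn f (s i)) (hs : ∀ i ∈ t, IsClosed (s i)) :
    ContinuousOn f (⋃ i ∈ t, s i) := by
  induction t using Finset.induction_on with
  | empty => simp
  | insert a t ha ih =>
    rw [Finset.set_biUnion_insert]
    exact ContinuousOn.union_of_isClosed (hf a (Finset.mem_insert_self a t))
      (ih (fun i hi => hf i (Finset.mem_insert_of_mem hi))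
        fun i hi => hs i (Finset.mem_insert_of_mem hi))
      (hs a (Finset.mem_insert_self a t))
      (isClosed_biUnion_finset fun i hi => hs i (Finset.mem_insert_of_mem hi))

theorem support_eq_of_mem_simplexFace {ι : Type*} {σ : Finset ι} {x : ι → ℝ}
    (hx : x ∈ simplexFace σ) (hb : x ∉ simplexFaceBoundary σ) : Function.support x = σ := by
  ext i
  constructor
  · intro hi
    by_contra h
    exact hi (hx.2.1 i h)
  · intro hi h
    exact hb ⟨hx, i, hi, h⟩

theorem support_subset_of_mem_simplexFace {ι : Type*} {σ : Finset ι} {x : ι → ℝ}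
    (hx : x ∈ simplexFace σ) : Function.support x ⊆ σ := fun i hi => by
  by_contra h
  exact hi (hx.2.1 i h)

/-- A full realization: a partial realization `w` of the complex `L` on its vertices extends
simplex by simplex, the images of the `j`-simplices being controlled by the scale `s j`. -/
theorem exists_realization {ι X : Type*} [MetricSpace X] [Nonempty X] {W : Set X} {d : ℕ}
    {L : Set (Finset ι)} (hL : ∀ σ ∈ L, ∀ τ ⊆ σ, τ ∈ L) {w : ι → X}
    (hw : ∀ σ ∈ L, ∀ i ∈ σ, w i ∈ W) {s : ℕ → Finset ι → ℝ}
    (hs : ∀ j, ∀ σ ∈ L, ∀ τ ⊆ σ, τ.Nonempty → s j τ ≤ s j σ)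
    (hs' : ∀ σ, Monotone fun j => s j σ)
    (hs0 : ∀ σ ∈ L, ∀ i ∈ σ, ∀ i' ∈ σ, dist (w i) (w i') < s 0 σ)
    (hnull : ∀ j < d, ∀ σ ∈ L, σ.Nonempty → ∀ x, SphereNullIn j (Metric.ball x (2 * s j σ) ∩ W)
      (Metric.ball x (s (j + 1) σ - s 0 σ) ∩ W)) :
    ∃ F : (ι → ℝ) → X, ∀ σ ∈ L, σ.card ≤ d + 1 → ContinuousOn F (simplexFace σ) ∧
      ∀ x ∈ simplexFace σ, F x ∈ W ∧ ∀ i ∈ σ, dist (F x) (w i) < s d σ := by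
  classical
  have key : ∀ j ≤ d, ∃ F : (ι → ℝ) → X, ∀ σ ∈ L, σ.card ≤ j + 1 →
      ContinuousOn F (simplexFace σ) ∧
      ∀ x ∈ simplexFace σ, F x ∈ W ∧ ∀ i ∈ σ, dist (F x) (w i) < s j σ := by
    intro j
    induction j with
    | zero =>
      intro _
      let F : (ι → ℝ) → X := fun x => if h : ∃ i, x i = 1 then w h.choose else Classical.arbitrary X
      refine ⟨F, fun σ hσ hc => ?_⟩
      rcases σ.eq_empty_or_nonempty with rfl | hne
      · have : simplexFace (∅ : Finset ι) = ∅ := by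
          ext x; simp [simplexFace]
        rw [this]
        exact ⟨continuousOn_empty _, fun x hx => hx.elim⟩
      obtain ⟨i, rfl⟩ : ∃ i, σ = {i} :=
        Finset.card_eq_one.1 (le_antisymm hc (Finset.card_pos.2 hne))
      have hF : ∀ x ∈ simplexFace ({i} : Finset ι), F x = w i := by
        intro x hx
        have h1 : x i = 1 := by simpa using hx.2.2
        have h : ∃ i, x i = 1 := ⟨i, h1⟩
        have h2 : h.choose = i := by
          by_contra hne
          have := hx.2.1 h.choose (by simpa using hne)
          rw [h.choose_spec] at this
          exact one_ne_zero this
        simp only [F, h, dite_true, h2]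
      refine ⟨continuousOn_const.congr hF, fun x hx => ?_⟩
      rw [hF x hx]
      refine ⟨hw _ hσ i (Finset.mem_singleton_self i), fun i' hi' => ?_⟩
      exact hs0 _ hσ i (Finset.mem_singleton_self i) i' hi'
    | succ j ih =>
      intro hj
      obtain ⟨F, hF⟩ := ih (by omega)
      have hext : ∀ σ : Finset ι, ∃ G : (ι → ℝ) → X, σ ∈ L → σ.card = j + 2 →
          ContinuousOn G (simplexFace σ) ∧ (∀ x ∈ simplexFaceBoundary σ, G x = F x) ∧
          ∀ x ∈ simplexFace σ, G x ∈ W ∧ ∀ i ∈ σ, dist (G x) (w i) < s (j + 1) σ := by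
        intro σ
        by_cases hσ : σ ∈ L ∧ σ.card = j + 2
        swap
        · exact ⟨F, fun h1 h2 => (hσ ⟨h1, h2⟩).elim⟩
        obtain ⟨hσ, hc⟩ := hσ
        have hne : σ.Nonempty := Finset.card_pos.1 (by omega)
        obtain ⟨i₀, hi₀⟩ := hne
        have hce : ∀ i ∈ σ, (σ.erase i).card = j + 1 := fun i hi => by
          rw [Finset.card_erase_of_mem hi, hc]; rfl
        have hFe : ∀ i ∈ σ, _ := fun i hi =>
          hF (σ.erase i) (hL σ hσ _ (Finset.erase_subset i σ)) (hce i hi).le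
        have hb := simplexFaceBoundary_eq_biUnion σ
        -- The boundary image lies within s j σ of a vertex image, itself within s 0 σ ≤ s j σ of `w
        -- i₀`; hence the factor 2 in `hnull`. The s 0 σ subtracted from the target radius pays for
        -- passing from `w i₀` to the other vertices.
        obtain ⟨G, hG1, hG2, hG3⟩ := exists_extension_simplexFace
          (hnull j (by omega) σ hσ ⟨i₀, hi₀⟩ (w i₀)) hc (g := F) (by
            rw [hb]
            exact continuousOn_biUnion_of_isClosed σ (fun i hi => (hFe i hi).1)
              fun i _ => isClosed_simplexFace _) (by
            intro x hx
            rw [hb] at hx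
            simp only [mem_iUnion, exists_prop] at hx
            obtain ⟨i, hi, hx⟩ := hx
            have h1 := (hFe i hi).2 x hx
            refine ⟨?_, h1.1⟩
            obtain ⟨i₁, hi₁⟩ : (σ.erase i).Nonempty :=
              Finset.card_pos.1 (by rw [hce i hi]; omega)
            have h2 := h1.2 i₁ hi₁
            have h3 := hs0 σ hσ i₁ (Finset.mem_of_mem_erase hi₁) i₀ hi₀
            have h4 := hs j σ hσ _ (Finset.erase_subset i σ) ⟨i₁, hi₁⟩
            have h5 := hs' σ (Nat.zero_le j)
            have h6 := dist_triangle (F x) (w i₁) (w i₀)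
            simp only [] at h5
            rw [Metric.mem_ball]
            linarith)
        refine ⟨G, fun _ _ => ⟨hG1, hG2, fun x hx => ⟨(hG3 x hx).2, fun i hi => ?_⟩⟩⟩
        have h1 := (hG3 x hx).1
        rw [Metric.mem_ball] at h1
        have h2 := hs0 σ hσ i₀ hi₀ i hi
        have h3 := dist_triangle (G x) (w i₀) (w i)
        linarith
      choose G hG using hext
      -- A point interior to a simplex has that simplex as its support, so the fillings are glued by
      -- reading off the support; on boundaries they already agree with F.
      let F' : (ι → ℝ) → X := fun x =>
        if h : ∃ σ ∈ L, σ.card = j + 2 ∧ Function.support x = σ then G h.choose x else F x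
      have hF'F : ∀ σ : Finset ι, σ.card ≤ j + 1 → ∀ x ∈ simplexFace σ, F' x = F x := by
        intro σ hc x hx
        have h : ¬ ∃ σ ∈ L, σ.card = j + 2 ∧ Function.support x = σ := by
          rintro ⟨τ, -, hτc, hτ⟩
          have h1 := support_subset_of_mem_simplexFace hx
          rw [hτ, Finset.coe_subset] at h1
          have := Finset.card_le_card h1
          omega
        simp only [F', h, dite_false]
      have hF'G : ∀ σ ∈ L, σ.card = j + 2 → ∀ x ∈ simplexFace σ, F' x = G σ x := by
        intro σ hσ hc x hx
        by_cases hb : x ∈ simplexFaceBoundary σ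
        · rw [(hG σ hσ hc).2.1 x hb]
          obtain ⟨-, i, hi, hxi⟩ := hb
          refine hF'F (σ.erase i) ?_ x (mem_simplexFace_erase hx hxi)
          rw [Finset.card_erase_of_mem hi, hc]; rfl
        · have h1 := support_eq_of_mem_simplexFace hx hb
          have h : ∃ σ ∈ L, σ.card = j + 2 ∧ Function.support x = σ := ⟨σ, hσ, hc, h1⟩
          have h2 : h.choose = σ :=
            Finset.coe_injective (h.choose_spec.2.2.symm.trans h1)
          simp only [F', h, dite_true, h2]
      refine ⟨F', fun σ hσ hc => ?_⟩
      rcases Nat.lt_or_ge σ.card (j + 2) with hlt | hge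
      · obtain ⟨h1, h2⟩ := hF σ hσ (by omega)
        have h3 := hF'F σ (by omega)
        refine ⟨h1.congr h3, fun x hx => ?_⟩
        rw [h3 x hx]
        exact ⟨(h2 x hx).1, fun i hi => ((h2 x hx).2 i hi).trans_le (hs' σ (Nat.le_succ j))⟩
      · have hc' : σ.card = j + 2 := by omega
        obtain ⟨h1, -, h2⟩ := hG σ hσ hc'
        have h3 := hF'G σ hσ hc'
        refine ⟨h1.congr h3, fun x hx => ?_⟩
        rw [h3 x hx]
        exact h2 x hx
  exact key d le_rfl

/-! ### Uniform local connectivity of the complement -/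

theorem SphereNullIn.mono {X : Type*} [TopologicalSpace X] {m : ℕ} {A B A' B' : Set X}
    (h : SphereNullIn m A B) (hA : A' ⊆ A) (hB : B ⊆ B') : SphereNullIn m A' B' := fun f hf => by
  obtain ⟨c, H, h0, h1, h2⟩ := h f fun u => hA (hf u)
  exact ⟨c, H, h0, h1, fun q => hB (h2 q)⟩

theorem InclusionTrivialPi.sphereNullIn {X : Type*} [TopologicalSpace X] {n : ℕ} {A B : Set X}
    {h : A ⊆ B} (hn : InclusionTrivialPi n h) {i : ℕ} (hi : i ≤ n) : SphereNullIn i A B := by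
  intro f hf
  obtain ⟨c, ⟨H⟩⟩ := hn i hi ⟨fun u => ⟨f u, hf u⟩, by fun_prop⟩
  refine ⟨c, ⟨fun q => (H (q.2, q.1) : X), by fun_prop⟩, fun u => ?_, fun u => ?_, fun q => ?_⟩
  · simp only [ContinuousMap.coe_mk, H.apply_zero]
    rfl
  · simp
  · exact (H (q.2, q.1)).2

/-- The dense part `W` of `X` is uniformly locally `n`-connected, also near the other points. -/
def UniformlyLC {X : Type*} [MetricSpace X] (n : ℕ) (W : Set X) : Prop :=
  ∀ ε > 0, ∃ δ > 0, ∀ x : X, ∀ i ≤ n,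
    SphereNullIn i (Metric.ball x δ ∩ W) (Metric.ball x ε ∩ W)

/-- At points of Z this is LCC^n; elsewhere it is LC^n of the complement, whose open sets are open
in X because Z is closed. The two local hypotheses are thus merged into one condition at every point
of X. -/
theorem exists_sphereNullIn_compl {X : Type*} [TopologicalSpace X] {n : ℕ} {Z : Set X}
    (hZc : IsClosed Z) (hLCC : IsLCC n Z) (hLC : IsLC n (Zᶜ : Set X)) (x : X) {U : Set X}
    (hU : IsOpen U) (hx : x ∈ U) :
    ∃ V : Set X, IsOpen V ∧ x ∈ V ∧ ∀ i ≤ n, SphereNullIn i (V ∩ Zᶜ) (U ∩ Zᶜ) := by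
  by_cases hxZ : x ∈ Z
  · obtain ⟨V, hV, hxV, h, hn⟩ := hLCC x hxZ U hU hx
    exact ⟨V, hV, hxV, fun i hi => hn.sphereNullIn hi⟩
  · obtain ⟨V, hV, hxV, h, hn⟩ := hLC ⟨x, hxZ⟩ (Subtype.val ⁻¹' U)
      (hU.preimage continuous_subtype_val) hx
    refine ⟨Subtype.val '' V, hZc.isOpen_compl.isOpenMap_subtype_val V hV, ⟨_, hxV, rfl⟩,
      fun i hi f hf => ?_⟩
    have hf' : ∀ u, ∃ hu : f u ∈ Zᶜ, (⟨f u, hu⟩ : (Zᶜ : Set X)) ∈ V := by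
      intro u
      obtain ⟨⟨y, hy, hyu⟩, h2⟩ := hf u
      refine ⟨h2, ?_⟩
      convert hy
      exact hyu.symm
    obtain ⟨c, H, h0, h1, h2⟩ := hn.sphereNullIn hi ⟨fun u => ⟨f u, (hf' u).1⟩, by fun_prop⟩
      fun u => (hf' u).2
    refine ⟨c, ⟨fun q => (H q : X), by fun_prop⟩, fun u => ?_, fun u => ?_, fun q => ?_⟩
    · simp [h0]
    · simp [h1]
    · exact ⟨h2 q, (H q).2⟩

/-- A Lebesgue number of the cover by the local neighbourhoods serves as δ for all centres at once.
-/
theorem uniformlyLC_compl {X : Type*} [MetricSpace X] [CompactSpace X] {n : ℕ} {Z : Set X}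
    (hZc : IsClosed Z) (hLCC : IsLCC n Z) (hLC : IsLC n (Zᶜ : Set X)) : UniformlyLC n Zᶜ := by
  intro ε hε
  choose V hV hxV hn using fun x : X =>
    exists_sphereNullIn_compl hZc hLCC hLC x (Metric.isOpen_ball (x := x) (ε := ε / 2))
      (Metric.mem_ball_self (half_pos hε))
  obtain ⟨δ, hδ, h⟩ := lebesgue_number_lemma_of_metric (isCompact_univ (X := X))
    (c := fun x => V x ∩ Metric.ball x (ε / 2)) (fun x => (hV x).inter Metric.isOpen_ball)
    fun x _ => mem_iUnion.2 ⟨x, hxV x, Metric.mem_ball_self (half_pos hε)⟩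
  refine ⟨δ, hδ, fun x i hi => ?_⟩
  obtain ⟨z, hz⟩ := h x (mem_univ x)
  have hxz := (hz (Metric.mem_ball_self hδ)).2
  refine (hn z i hi).mono (inter_subset_inter_left _ fun y hy => (hz hy).1)
    (inter_subset_inter_left _ (Metric.ball_subset_ball' ?_))
  rw [Metric.mem_ball, dist_comm] at hxz
  linarith

/-- Iterating the modulus of uniform connectivity gives one sequence of radii in which raising the
skeleton by one dimension costs one step. The factors 2 and 1/2 are the slack spent in
`exists_realization`. -/
theorem UniformlyLC.exists_scale {X : Type*} [MetricSpace X] {n : ℕ} {W : Set X}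
    (h : UniformlyLC n W) : ∃ e : ℕ → ℝ, (∀ m, 0 < e m) ∧ (∀ m, e (m + 1) ≤ e m / 2) ∧
      ∀ m, ∀ x, ∀ i ≤ n, SphereNullIn i (Metric.ball x (2 * e (m + 1)) ∩ W)
        (Metric.ball x (e m / 2) ∩ W) := by
  choose δ hδ hn using h
  let nx : {r : ℝ // 0 < r} → {r : ℝ // 0 < r} := fun r =>
    ⟨min (δ (r / 2) (half_pos r.2) / 2) (r / 2), lt_min (half_pos (hδ _ _)) (half_pos r.2)⟩
  let e : ℕ → {r : ℝ // 0 < r} := fun m => nx^[m] ⟨1, one_pos⟩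
  have he : ∀ m, e (m + 1) = nx (e m) := fun m => Function.iterate_succ_apply' nx m _
  refine ⟨fun m => e m, fun m => (e m).2, fun m => ?_, fun m x i hi => ?_⟩
  · simp only [he]
    exact min_le_right _ _
  · refine (hn (e m / 2) (half_pos (e m).2) x i hi).mono (inter_subset_inter_left _
      (Metric.ball_subset_ball ?_)) subset_rfl
    simp only [he]
    have : ((nx (e m) : {r : ℝ // 0 < r}) : ℝ) ≤ _ := min_le_left _ _
    linarith

/-! ### Refining covers and a map on their joint nerve -/

/-- A sequence of finite open covers of order at most `n + 1`, each refining the previous one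
through `p`, the members of the `k`-th one being smaller than `ε k`. -/
structure RefiningCovers (X : Type*) [MetricSpace X] (n : ℕ) (ε : ℕ → ℝ) where
  v : ℕ → ℕ → Set X
  N : ℕ → ℕ
  p : ℕ → ℕ → ℕ
  isOpen : ∀ k i, IsOpen (v k i)
  lt_of_mem : ∀ k i x, x ∈ v k i → i < N k
  exists_mem : ∀ k x, ∃ i, x ∈ v k i
  card_le : ∀ k x, ∀ s : Finset ℕ, (∀ i ∈ s, x ∈ v k i) → s.card ≤ n + 1
  dist_lt : ∀ k i, ∀ x ∈ v k i, ∀ y ∈ v k i, dist x y < ε k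
  mem_p : ∀ k i, ∀ x ∈ v (k + 1) i, x ∈ v k (p k i)

/-- The dimension hypothesis is applied to the given cover intersected with finitely many balls of
radius ε/2, so that its refinement is both subordinate and fine. -/
theorem CoveringDimLE.exists_refinement {X : Type*} [MetricSpace X] [CompactSpace X] {n : ℕ}
    (hdim : CoveringDimLE n X) {ε : ℝ} (hε : 0 < ε) {u : ℕ → Set X} {M : ℕ}
    (hu : ∀ i, IsOpen (u i)) (huM : ∀ i x, x ∈ u i → i < M) (huc : ∀ x, ∃ i, x ∈ u i) :
    ∃ (v : ℕ → Set X) (N : ℕ) (p : ℕ → ℕ), (∀ i, IsOpen (v i)) ∧ (∀ i x, x ∈ v i → i < N) ∧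
      (∀ x, ∃ i, x ∈ v i) ∧ (∀ x, ∀ s : Finset ℕ, (∀ i ∈ s, x ∈ v i) → s.card ≤ n + 1) ∧
      (∀ i, ∀ x ∈ v i, ∀ y ∈ v i, dist x y < ε) ∧ ∀ i, ∀ x ∈ v i, x ∈ u (p i) := by
  classical
  obtain ⟨t, ht, htc⟩ := Metric.totallyBounded_iff.1 (isCompact_univ (X := X)).totallyBounded
    (ε / 2) (half_pos hε)
  let g : ℕ × X → Set X := fun q => u q.1 ∩ Metric.ball q.2 (ε / 2)
  obtain ⟨V, hVf, hVo, hVc, hVr, hVn⟩ := hdim (g '' (Iio M ×ˢ t)) (((finite_Iio M).prod ht).image g)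
    (by rintro _ ⟨q, -, rfl⟩; exact (hu _).inter Metric.isOpen_ball)
    (by
      refine eq_univ_of_forall fun x => ?_
      obtain ⟨i, hi⟩ := huc x
      have := htc (mem_univ x)
      simp only [mem_iUnion, exists_prop] at this
      obtain ⟨c, hc, hxc⟩ := this
      exact ⟨g (i, c), ⟨(i, c), ⟨huM i x hi, hc⟩, rfl⟩, hi, hxc⟩)
  have hp : ∀ A : Set X, ∃ i, A ∈ V → A ⊆ u i := by
    intro A
    by_cases hA : A ∈ V
    · obtain ⟨_, ⟨q, -, rfl⟩, h⟩ := hVr A hA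
      exact ⟨q.1, fun _ => h.trans inter_subset_left⟩
    · exact ⟨0, fun h => (hA h).elim⟩
  choose p hp using hp
  let a := hVf.toFinset.equivFin
  let v : ℕ → Set X := fun i => if h : i < hVf.toFinset.card then a.symm ⟨i, h⟩ else ∅
  have hv : ∀ i x, x ∈ v i → i < hVf.toFinset.card := by
    intro i x hx
    by_contra h
    simp [v, h] at hx
  have hvV : ∀ i, i < hVf.toFinset.card → v i ∈ V := by
    intro i hi
    simp only [v, hi, dite_true]
    exact hVf.mem_toFinset.1 (a.symm ⟨i, hi⟩).2
  refine ⟨v, hVf.toFinset.card, fun i => p (v i), fun i => ?_, hv, fun x => ?_, fun x s hs => ?_,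
    fun i x hx y hy => ?_, fun i x hx => ?_⟩
  · by_cases h : i < hVf.toFinset.card
    · exact hVo _ (hvV i h)
    · simp [v, h]
  · have : x ∈ ⋃₀ V := hVc ▸ mem_univ x
    obtain ⟨A, hA, hx⟩ := this
    refine ⟨a ⟨A, hVf.mem_toFinset.2 hA⟩, ?_⟩
    simpa [v] using hx
  -- Distinct nonempty indices name distinct members of V, so a bound on members through x bounds
  -- the number of indices.
  · have hinj : InjOn v s := by
      intro i hi j hj hij
      have h1 := hv i x (hs i hi)
      have h2 := hv j x (hs j hj)
      simp only [v, h1, h2, dite_true] at hij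
      have := a.symm.injective (Subtype.ext hij)
      simpa using this
    have h1 : (v '' s) ⊆ {A ∈ V | x ∈ A} := by
      rintro _ ⟨i, hi, rfl⟩
      exact ⟨hvV i (hv i x (hs i hi)), hs i hi⟩
    have h2 := (encard_le_encard h1).trans (hVn x)
    rw [hinj.encard_image, encard_coe_eq_coe_finsetCard] at h2
    exact_mod_cast h2
  · obtain ⟨_, ⟨q, -, rfl⟩, h⟩ := hVr _ (hvV i (hv i x hx))
    have h1 := (h hx).2
    have h2 := (h hy).2
    rw [Metric.mem_ball] at h1 h2
    have := dist_triangle_right x y q.2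
    linarith
  · exact hp _ (hvV i (hv i x hx)) hx

theorem CoveringDimLE.nonempty_refiningCovers {X : Type*} [MetricSpace X] [CompactSpace X] {n : ℕ}
    (hdim : CoveringDimLE n X) {ε : ℕ → ℝ} (hε : ∀ k, 0 < ε k) :
    Nonempty (RefiningCovers X n ε) := by
  let C : Type _ := {q : (ℕ → Set X) × ℕ //
    (∀ i, IsOpen (q.1 i)) ∧ (∀ i x, x ∈ q.1 i → i < q.2) ∧ ∀ x, ∃ i, x ∈ q.1 i}
  choose v N p ho hN hc hn hd hp using fun (k : ℕ) (q : C) =>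
    hdim.exists_refinement (hε k) q.2.1 q.2.2.1 q.2.2.2
  let nx : ℕ → C → C := fun k q => ⟨(v k q, N k q), ho k q, hN k q, hc k q⟩
  let q₀ : C := ⟨(fun i => if i = 0 then univ else ∅, 1), fun i => by dsimp; split_ifs <;> simp,
    fun i x hx => by
      by_contra h
      have : i ≠ 0 := by rintro rfl; exact h one_pos
      simp [this] at hx, fun x => ⟨0, by simp⟩⟩
  let Q : ℕ → C := fun k => Nat.rec q₀ nx k
  exact ⟨{
    v := fun k => v k (Q k)
    N := fun k => N k (Q k)
    -- `Q (k + 1)` holds the k-th cover, `Q 0` being the trivial one; hence the shift.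
    p := fun k => p (k + 1) (Q (k + 1))
    isOpen := fun k => ho k (Q k)
    lt_of_mem := fun k => hN k (Q k)
    exists_mem := fun k => hc k (Q k)
    card_le := fun k => hn k (Q k)
    dist_lt := fun k => hd k (Q k)
    mem_p := fun k => hp (k + 1) (Q (k + 1)) }⟩

/-- The complex realized is the nerve of all members of all levels together, restricted to simplices
with at most n + 2 vertices. The size of an image is governed by the coarsest level among the
vertices. -/
theorem exists_covers_realization {X : Type*} [MetricSpace X] [CompactSpace X] [Nonempty X]
    {n : ℕ} {W : Set X} (hW : Dense W) (hdim : CoveringDimLE n X) (hLC : UniformlyLC n W) :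
    ∃ (ε e : ℕ → ℝ) (C : RefiningCovers X n ε) (F : (ℕ × ℕ → ℝ) → X),
      Filter.Tendsto e Filter.atTop (𝓝 0) ∧ ∀ σ : Finset (ℕ × ℕ), σ.card ≤ n + 2 →
        ∀ z, (∀ q ∈ σ, z ∈ C.v q.1 q.2) → ContinuousOn F (simplexFace σ) ∧
          ∀ x ∈ simplexFace σ, F x ∈ W ∧ ∀ k, (∀ q ∈ σ, k ≤ q.1) → dist (F x) z ≤ e k := by
  classical
  obtain ⟨e, he0, he, hnull⟩ := hLC.exists_scale
  have hanti : Antitone e := antitone_nat_of_succ_le fun m => by linarith [he m, he0 m]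
  have hpow : ∀ m, e m ≤ e 0 * (1 / 2) ^ m := by
    intro m
    induction m with
    | zero => simp
    | succ m ih => rw [pow_succ]; linarith [he m]
  have hlim : Filter.Tendsto e Filter.atTop (𝓝 0) := by
    refine squeeze_zero (fun m => (he0 m).le) hpow ?_
    have := (tendsto_pow_atTop_nhds_zero_of_lt_one (r := (1 / 2 : ℝ)) (by norm_num)
      (by norm_num)).const_mul (e 0)
    simpa using this
  -- The extension climbs n + 1 dimensions, losing one step of the scale each time; starting at
  -- index k + (n + 1) it ends at e k.
  obtain ⟨C⟩ := hdim.nonempty_refiningCovers (ε := fun k => e (k + (n + 1)) / 2)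
    fun k => half_pos (he0 _)
  have hw : ∀ q : ℕ × ℕ, ∃ w : X, (C.v q.1 q.2).Nonempty → w ∈ C.v q.1 q.2 ∩ W := by
    intro q
    by_cases h : (C.v q.1 q.2).Nonempty
    · obtain ⟨w, hw⟩ := hW.inter_open_nonempty _ (C.isOpen q.1 q.2) h
      exact ⟨w, fun _ => hw⟩
    · exact ⟨Classical.arbitrary X, fun h' => (h h').elim⟩
  choose w hw using hw
  -- The coarsest level in σ. It is 0 for the empty set, which is why monotonicity of the scale is
  -- asked only for nonempty faces.
  let κ : Finset (ℕ × ℕ) → ℕ := fun σ => sInf (Prod.fst '' (σ : Set (ℕ × ℕ)))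
  have hκle : ∀ σ : Finset (ℕ × ℕ), ∀ q ∈ σ, κ σ ≤ q.1 := fun σ q hq =>
    Nat.sInf_le ⟨q, hq, rfl⟩
  have hκ : ∀ σ : Finset (ℕ × ℕ), σ.Nonempty → ∃ q ∈ σ, q.1 = κ σ := fun σ hσ =>
    Nat.sInf_mem (s := Prod.fst '' (σ : Set (ℕ × ℕ))) (hσ.to_set.image _)
  have hdw : ∀ (σ : Finset (ℕ × ℕ)) (z : X), (∀ q ∈ σ, z ∈ C.v q.1 q.2) → ∀ q ∈ σ,
      dist (w q) z < e (κ σ + (n + 1)) / 2 := by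
    intro σ z hz q hq
    refine (C.dist_lt q.1 q.2 _ (hw q ⟨z, hz q hq⟩).1 z (hz q hq)).trans_le ?_
    have := hanti (Nat.add_le_add_right (hκle σ q hq) (n + 1))
    linarith
  obtain ⟨F, hF⟩ := exists_realization (X := X) (W := W) (d := n + 1)
    (L := {σ : Finset (ℕ × ℕ) | ∃ z, ∀ q ∈ σ, z ∈ C.v q.1 q.2})
    (fun σ ⟨z, hz⟩ τ hτ => ⟨z, fun q hq => hz q (hτ hq)⟩) (w := w)
    (fun σ ⟨z, hz⟩ q hq => (hw q ⟨z, hz q hq⟩).2)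
    (s := fun j σ => e (κ σ + (n + 1 - j)))
    (fun j σ _ τ hτ hne => by
      obtain ⟨q, hq, hqκ⟩ := hκ τ hne
      refine hanti (Nat.add_le_add_right ?_ _)
      rw [← hqκ]
      exact hκle σ q (hτ hq))
    (fun σ j j' h => hanti (by omega))
    (fun σ ⟨z, hz⟩ q hq q' hq' => by
      have h1 := hdw σ z hz q hq
      have h2 := hdw σ z hz q' hq'
      have h3 := dist_triangle_right (w q) (w q') z
      simp only [Nat.sub_zero]
      linarith)
    (fun j hj σ _ _ x => by
      obtain ⟨r, rfl⟩ : ∃ r, n = r + j := ⟨n - j, by omega⟩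
      have h1 : κ σ + (r + j + 1 - j) = κ σ + r + 1 := by omega
      have h2 : κ σ + (r + j + 1 - (j + 1)) = κ σ + r := by omega
      simp only [h1, h2, Nat.sub_zero]
      refine (hnull (κ σ + r) x j (by omega)).mono subset_rfl
        (inter_subset_inter_left _ (Metric.ball_subset_ball ?_))
      have h3 := he (κ σ + r)
      have h4 : e (κ σ + (r + j + 1)) ≤ e (κ σ + r + 1) := hanti (by omega)
      linarith)
  refine ⟨_, fun k => 2 * e k, C, F, by simpa using hlim.const_mul 2, fun σ hc z hz => ?_⟩
  obtain ⟨h1, h2⟩ := hF σ ⟨z, hz⟩ hc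
  refine ⟨h1, fun x hx => ⟨(h2 x hx).1, fun k hk => ?_⟩⟩
  have hne : σ.Nonempty := by
    by_contra h
    rw [Finset.not_nonempty_iff_eq_empty] at h
    have := hx.2.2
    rw [h, Finset.sum_empty] at this
    exact zero_ne_one this
  obtain ⟨q, hq, hqκ⟩ := hκ σ hne
  have h3 := (h2 x hx).2 q hq
  have h4 := hdw σ z hz q hq
  simp only [Nat.sub_self, add_zero] at h3
  have h5 : e (κ σ) ≤ e k := hanti (hqκ ▸ hk q hq)
  have h6 : e (κ σ + (n + 1)) ≤ e (κ σ) := hanti (by omega)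
  have h7 := dist_triangle (F x) (w q) z
  linarith [he0 (κ σ)]

/-! ### Paths in the mapping telescope of the nerves -/

/-- The part of the mass `θ i` lying below the height `t` when the masses are stacked in order. -/
noncomputable def massBelow (θ : ℕ → ℝ) (t : ℝ) (i : ℕ) : ℝ :=
  min (∑ j ∈ Finset.range (i + 1), θ j) t - min (∑ j ∈ Finset.range i, θ j) t

/-- A point of the `k`-th stage of the mapping telescope: it moves from `θ` at level `k` to `θ'` at
level `k + 1`, first within level `k` (parameter `s`), then along the mapping cylinder of `p`
(parameter `t`, decreasing). -/
noncomputable def bridge (k N : ℕ) (p : ℕ → ℕ) (θ θ' : ℕ → ℝ) (s t : ℝ) : ℕ × ℕ → ℝ := fun q =>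
  if q.1 = k then
    (1 - s) * θ q.2 + s * ∑ i ∈ Finset.range N, if p i = q.2 then massBelow θ' t i else 0
  else if q.1 = k + 1 then s * (θ' q.2 - massBelow θ' t q.2) else 0

theorem massBelow_nonneg {θ : ℕ → ℝ} (hθ : ∀ i, 0 ≤ θ i) (t : ℝ) (i : ℕ) : 0 ≤ massBelow θ t i := by
  unfold massBelow
  rw [Finset.sum_range_succ, sub_nonneg]
  exact min_le_min_right _ (le_add_of_nonneg_right (hθ i))

theorem massBelow_le {θ : ℕ → ℝ} (hθ : ∀ i, 0 ≤ θ i) (t : ℝ) (i : ℕ) : massBelow θ t i ≤ θ i := by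
  have := hθ i
  unfold massBelow
  rw [Finset.sum_range_succ]
  generalize ∑ j ∈ Finset.range i, θ j = c
  rcases min_cases (c + θ i) t with h | h <;> rcases min_cases c t with h' | h' <;> linarith

theorem massBelow_zero {θ : ℕ → ℝ} (hθ : ∀ i, 0 ≤ θ i) (i : ℕ) : massBelow θ 0 i = 0 := by
  unfold massBelow
  rw [min_eq_right (Finset.sum_nonneg fun j _ => hθ j),
    min_eq_right (Finset.sum_nonneg fun j _ => hθ j), sub_zero]

theorem massBelow_of_sum_le {θ : ℕ → ℝ} {t : ℝ} (h : ∀ i, ∑ j ∈ Finset.range i, θ j ≤ t) (i : ℕ) :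
    massBelow θ t i = θ i := by
  unfold massBelow
  rw [min_eq_left (h _), min_eq_left (h _), Finset.sum_range_succ]
  ring

theorem sum_lt_of_massBelow_pos {θ : ℕ → ℝ} {t : ℝ} {i : ℕ} (h : 0 < massBelow θ t i) :
    ∑ j ∈ Finset.range i, θ j < t := by
  by_contra! hc
  unfold massBelow at h
  rw [min_eq_right hc] at h
  linarith [min_le_right (∑ j ∈ Finset.range (i + 1), θ j) t]

theorem lt_sum_of_massBelow_lt {θ : ℕ → ℝ} (hθ : ∀ i, 0 ≤ θ i) {t : ℝ} {i : ℕ}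
    (h : massBelow θ t i < θ i) : t < ∑ j ∈ Finset.range (i + 1), θ j := by
  by_contra! hc
  have h1 : ∑ j ∈ Finset.range i, θ j ≤ t := by
    refine le_trans ?_ hc
    rw [Finset.sum_range_succ]
    exact le_add_of_nonneg_right (hθ i)
  unfold massBelow at h
  rw [min_eq_left hc, min_eq_left h1, Finset.sum_range_succ] at h
  linarith

/-- Since p carries A' into A, mass pushed down by p lands on vertices already allowed. What is
gained at level k is lost at level k + 1, so the total stays 1. -/
theorem bridge_mem_simplexFace {k M N : ℕ} {p : ℕ → ℕ} {θ θ' : ℕ → ℝ} {s t : ℝ}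
    (hθ : ∀ i, 0 ≤ θ i) (hθ' : ∀ i, 0 ≤ θ' i) (hs0 : 0 ≤ s) (hs1 : s ≤ 1) {A A' : Finset ℕ}
    (hA : ∀ i, θ i ≠ 0 → i ∈ A) (hA' : ∀ i, θ' i ≠ 0 → i ∈ A')
    (hM : ∀ i ∈ A, i < M) (hN : ∀ i ∈ A', i < N) (hp : ∀ i ∈ A', p i ∈ A)
    (hsum : ∑ i ∈ Finset.range M, θ i = 1) (hsum' : ∑ i ∈ Finset.range N, θ' i = 1) :
    bridge k N p θ θ' s t ∈ simplexFace (({k} ×ˢ A) ∪ ({k + 1} ×ˢ A')) := by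
  have hm0 : ∀ i ∉ A', massBelow θ' t i = 0 := fun i hi => by
    have h1 : θ' i = 0 := by by_contra h; exact hi (hA' i h)
    exact le_antisymm (h1 ▸ massBelow_le hθ' t i) (massBelow_nonneg hθ' t i)
  refine ⟨fun q => ?_, fun q hq => ?_, ?_⟩
  · unfold bridge
    split_ifs
    · refine add_nonneg (mul_nonneg (by linarith) (hθ _)) (mul_nonneg hs0
        (Finset.sum_nonneg fun i _ => ?_))
      split_ifs
      · exact massBelow_nonneg hθ' t i
      · exact le_rfl
    · exact mul_nonneg hs0 (by linarith [massBelow_le hθ' t q.2])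
    · exact le_rfl
  · simp only [Finset.mem_union, Finset.mem_product, Finset.mem_singleton, not_or, not_and] at hq
    unfold bridge
    split_ifs with h1 h2
    · have h3 := hq.1 h1
      have h4 : θ q.2 = 0 := by by_contra h; exact h3 (hA _ h)
      rw [h4, Finset.sum_eq_zero]
      · simp
      · intro i _
        split_ifs with h5
        · exact hm0 i fun h6 => h3 (h5 ▸ hp i h6)
        · rfl
    · have h3 := hq.2 h2
      have h4 : θ' q.2 = 0 := by by_contra h; exact h3 (hA' _ h)
      rw [h4, hm0 _ h3]
      simp
    · rfl
  · rw [Finset.sum_union (by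
      rw [Finset.disjoint_left]
      rintro ⟨a, b⟩ h1 h2
      simp only [Finset.mem_product, Finset.mem_singleton] at h1 h2
      omega), Finset.sum_product, Finset.sum_product, Finset.sum_singleton, Finset.sum_singleton]
    have e1 : ∑ i ∈ A, θ i = 1 := by
      rw [← hsum]
      exact Finset.sum_subset (fun i hi => Finset.mem_range.2 (hM i hi)) fun i _ hi => by
        by_contra h; exact hi (hA i h)
    have e2 : ∑ i ∈ A', (θ' i - massBelow θ' t i) =
        1 - ∑ i ∈ Finset.range N, massBelow θ' t i := by
      rw [← hsum', ← Finset.sum_sub_distrib]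
      exact Finset.sum_subset (fun i hi => Finset.mem_range.2 (hN i hi)) fun i _ hi => by
        rw [hm0 i hi, sub_zero]; by_contra h; exact hi (hA' i h)
    have e3 : ∑ m ∈ A, ∑ i ∈ Finset.range N, (if p i = m then massBelow θ' t i else 0) =
        ∑ i ∈ Finset.range N, massBelow θ' t i := by
      rw [Finset.sum_comm]
      refine Finset.sum_congr rfl fun i _ => ?_
      rw [Finset.sum_ite_eq]
      split_ifs with h
      · rfl
      · exact (hm0 i fun h' => h (hp i h')).symm
    simp only [bridge, if_true, Nat.succ_ne_self, if_false]
    rw [Finset.sum_add_distrib, ← Finset.mul_sum, ← Finset.mul_sum, ← Finset.mul_sum, e1, e2, e3]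
    ring

/-- The bound n + 2 is what stacking the masses in order achieves. When s = 1, only the one mass
straddling height t can contribute to both levels, so at most one vertex is added to the n + 1 of
A'; this is the usual triangulation of a simplicial mapping cylinder. When t = 1, everything lies in
A at level k. -/
theorem exists_simplexFace_bridge {k M N n : ℕ} {p : ℕ → ℕ} {θ θ' : ℕ → ℝ} {s t : ℝ}
    (hθ : ∀ i, 0 ≤ θ i) (hθ' : ∀ i, 0 ≤ θ' i) (hs0 : 0 ≤ s) (hs1 : s ≤ 1)
    (hst : s = 1 ∨ t = 1) {A A' : Finset ℕ}
    (hA : ∀ i, θ i ≠ 0 → i ∈ A) (hA' : ∀ i, θ' i ≠ 0 → i ∈ A')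
    (hM : ∀ i ∈ A, i < M) (hN : ∀ i ∈ A', i < N) (hp : ∀ i ∈ A', p i ∈ A)
    (hAn : A.card ≤ n + 1) (hAn' : A'.card ≤ n + 1)
    (hsum : ∑ i ∈ Finset.range M, θ i = 1) (hsum' : ∑ i ∈ Finset.range N, θ' i = 1) :
    ∃ σ ⊆ ({k} ×ˢ A) ∪ ({k + 1} ×ˢ A'), σ.card ≤ n + 2 ∧
      bridge k N p θ θ' s t ∈ simplexFace σ := by
  classical
  set x := bridge k N p θ θ' s t with hx
  have hmem : x ∈ simplexFace (({k} ×ˢ A) ∪ ({k + 1} ×ˢ A')) :=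
    bridge_mem_simplexFace hθ hθ' hs0 hs1 hA hA' hM hN hp hsum hsum'
  refine ⟨(({k} ×ˢ A) ∪ ({k + 1} ×ˢ A')).filter (fun q => x q ≠ 0), Finset.filter_subset _ _, ?_,
    hmem.1, fun q hq => ?_, ?_⟩
  · rcases hst with rfl | rfl
    · let I := A'.filter fun i => 0 < massBelow θ' t i
      let J := A'.filter fun i => massBelow θ' t i < θ' i
      have hsub : (({k} ×ˢ A) ∪ ({k + 1} ×ˢ A')).filter (fun q => x q ≠ 0) ⊆
          I.image (fun i => (k, p i)) ∪ J.image (fun i => (k + 1, i)) := by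
        rintro ⟨a, b⟩ hq
        rw [Finset.mem_filter, Finset.mem_union] at hq
        obtain ⟨hq, hxq⟩ := hq
        rw [Finset.mem_union]
        rcases hq with hq | hq
        · left
          simp only [Finset.mem_product, Finset.mem_singleton] at hq
          obtain ⟨rfl, hb⟩ := hq
          simp only [hx, bridge, if_true, sub_self, zero_mul, zero_add, one_mul] at hxq
          obtain ⟨i, -, hi⟩ := Finset.exists_ne_zero_of_sum_ne_zero hxq
          have hpi : p i = b := by by_contra h; simp [h] at hi
          simp only [hpi, if_true] at hi
          have hpos := lt_of_le_of_ne (massBelow_nonneg hθ' t i) (Ne.symm hi)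
          refine Finset.mem_image.2 ⟨i, Finset.mem_filter.2 ⟨hA' i ?_, hpos⟩, by rw [hpi]⟩
          exact (hpos.trans_le (massBelow_le hθ' t i)).ne'
        · right
          simp only [Finset.mem_product, Finset.mem_singleton] at hq
          obtain ⟨rfl, hb⟩ := hq
          simp only [hx, bridge, if_true, Nat.succ_ne_self, if_false, one_mul] at hxq
          refine Finset.mem_image.2 ⟨b, Finset.mem_filter.2 ⟨hb, ?_⟩, rfl⟩
          exact lt_of_le_of_ne (massBelow_le hθ' t b) fun h => hxq (by rw [h, sub_self])
      have hIJ : (I ∩ J).card ≤ 1 := by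
        have hlt : ∀ i ∈ I ∩ J, ∀ j ∈ I ∩ J, ¬ i < j := by
          intro i hi j hj hij
          have h1 := lt_sum_of_massBelow_lt hθ'
            (Finset.mem_filter.1 (Finset.mem_of_mem_inter_right hi)).2
          have h2 := sum_lt_of_massBelow_pos
            (Finset.mem_filter.1 (Finset.mem_of_mem_inter_left hj)).2
          have h3 : ∑ a ∈ Finset.range (i + 1), θ' a ≤ ∑ a ∈ Finset.range j, θ' a :=
            Finset.sum_le_sum_of_subset_of_nonneg (Finset.range_subset_range.2 hij)
              fun a _ _ => hθ' a
          linarith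
        rw [Finset.card_le_one]
        intro i hi j hj
        have h1 := hlt i hi j hj
        have h2 := hlt j hj i hi
        omega
      have hU : (I ∪ J).card ≤ A'.card :=
        Finset.card_le_card (Finset.union_subset (Finset.filter_subset _ _)
          (Finset.filter_subset _ _))
      have h1 := Finset.card_le_card hsub
      have h2 := Finset.card_union_le (I.image fun i => (k, p i)) (J.image fun i => (k + 1, i))
      have h3 := Finset.card_image_le (s := I) (f := fun i => (k, p i))
      have h4 := Finset.card_image_le (s := J) (f := fun i => (k + 1, i))
      have h5 := Finset.card_union_add_card_inter I J
      omega
    · have hc : ∀ i, ∑ j ∈ Finset.range i, θ' j ≤ 1 := by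
        intro i
        rw [← hsum']
        rcases le_total i N with h | h
        · exact Finset.sum_le_sum_of_subset_of_nonneg (Finset.range_subset_range.2 h)
            fun a _ _ => hθ' a
        · refine (Finset.sum_subset (Finset.range_subset_range.2 h) fun a _ ha => ?_).ge
          by_contra h'
          exact ha (Finset.mem_range.2 (hN a (hA' a h')))
      have hsub : (({k} ×ˢ A) ∪ ({k + 1} ×ˢ A')).filter (fun q => x q ≠ 0) ⊆ {k} ×ˢ A := by
        rintro ⟨a, b⟩ hq
        rw [Finset.mem_filter, Finset.mem_union] at hq
        obtain ⟨hq | hq, hxq⟩ := hq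
        · exact hq
        · simp only [Finset.mem_product, Finset.mem_singleton] at hq
          obtain ⟨rfl, hb⟩ := hq
          exfalso
          apply hxq
          simp [hx, bridge, massBelow_of_sum_le hc]
      refine (Finset.card_le_card hsub).trans ?_
      rw [Finset.card_product, Finset.card_singleton]
      omega
  · by_contra h
    refine hq (Finset.mem_filter.2 ⟨?_, h⟩)
    by_contra h'
    exact h (hmem.2.1 q h')
  · rw [← hmem.2.2]
    exact Finset.sum_filter_ne_zero _

theorem bridge_zero_one (k N : ℕ) (p : ℕ → ℕ) (θ θ' : ℕ → ℝ) (q : ℕ × ℕ) :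
    bridge k N p θ θ' 0 1 q = if q.1 = k then θ q.2 else 0 := by
  simp [bridge]

theorem bridge_one_zero (k N : ℕ) (p : ℕ → ℕ) (θ : ℕ → ℝ) {θ' : ℕ → ℝ} (hθ' : ∀ i, 0 ≤ θ' i)
    (q : ℕ × ℕ) : bridge k N p θ θ' 1 0 q = if q.1 = k + 1 then θ' q.2 else 0 := by
  by_cases h : q.1 = k
  · simp [bridge, massBelow_zero hθ', h]
  · simp [bridge, massBelow_zero hθ', h]

theorem continuous_bridge {Y : Type*} [TopologicalSpace Y] (k N : ℕ) (p : ℕ → ℕ)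
    {θ θ' : ℕ → Y → ℝ} {s t : Y → ℝ} (hθ : ∀ i, Continuous (θ i)) (hθ' : ∀ i, Continuous (θ' i))
    (hs : Continuous s) (ht : Continuous t) :
    Continuous fun y => bridge k N p (fun i => θ i y) (fun i => θ' i y) (s y) (t y) := by
  have hm : ∀ i, Continuous fun y => massBelow (fun i => θ' i y) (t y) i := by
    intro i
    unfold massBelow
    fun_prop
  refine continuous_pi fun q => ?_
  unfold bridge
  split_ifs
  · refine ((continuous_const.sub hs).mul (hθ _)).add (hs.mul (continuous_finsetSum _ fun i _ => ?_))
    split_ifs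
    · exact hm i
    · exact continuous_const
  · exact hs.mul ((hθ' _).sub (hm _))
  · exact continuous_const

/-! ### The neighbourhood retraction -/

theorem exists_retraction_into {X Y : Type*} [MetricSpace X] [CompactSpace X] [Nonempty X]
    [MetricSpace Y] {e : X → Y} (he : Isometry e) {n : ℕ} {W : Set X} (hW : Dense W)
    (hdim : CoveringDimLE n X) (hLC : UniformlyLC n W) :
    ∃ O : Set Y, IsOpen O ∧ range e ⊆ O ∧ ∃ r : Y → X, ContinuousOn r O ∧ (∀ x, r (e x) = x) ∧
      ∀ y ∈ O, y ∉ range e → r y ∈ W := by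
  classical
  obtain ⟨ε, η, C, F, hη, hF⟩ := exists_covers_realization hW hdim hLC
  have hcomp : IsCompact (range e) := isCompact_range he.continuous
  have hne : (range e).Nonempty := range_nonempty e
  let D : Y → ℝ := fun y => Metric.infDist y (range e)
  have hDc : Continuous D := Metric.continuous_infDist_pt _
  have hD0 : ∀ y, 0 ≤ D y := fun y => Metric.infDist_nonneg
  have hDmem : ∀ y, D y = 0 ↔ y ∈ range e := fun y =>
    (hcomp.isClosed.mem_iff_infDist_zero hne).symm
  -- nearest points
  have hν : ∀ y, ∃ x, D y = dist y (e x) := by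
    intro y
    obtain ⟨_, ⟨x, rfl⟩, h⟩ := hcomp.exists_infDist_eq_dist hne y
    exact ⟨x, h⟩
  choose ν hν using hν
  -- extension of open sets of `X` to `Y`
  let Ex : Set X → Set Y := fun v =>
    {y | Metric.infEDist y (range e) < Metric.infEDist y (e '' vᶜ)}
  have hExo : ∀ v, IsOpen (Ex v) := fun v =>
    isOpen_lt Metric.continuous_infEDist Metric.continuous_infEDist
  -- Points of `Ex v` are strictly nearer to X than to the complement of v, so a nearest point lies
  -- in v. Extended distance is used because that complement may be empty. Consequently the extended
  -- sets containing y have `ν y` as a common point, and the order of the covers does not grow; ν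
  -- itself need not be continuous.
  have hExν : ∀ v y, y ∈ Ex v → ν y ∈ v := by
    intro v y hy
    by_contra h
    have h1 : Metric.infEDist y (e '' vᶜ) ≤ edist y (e (ν y)) :=
      Metric.infEDist_le_edist_of_mem ⟨ν y, h, rfl⟩
    have h2 : Metric.infEDist y (range e) = edist y (e (ν y)) := by
      rw [edist_dist, ← hν y]
      exact (ENNReal.ofReal_toReal (Metric.infEDist_ne_top hne)).symm
    have h3 : Metric.infEDist y (range e) < Metric.infEDist y (e '' vᶜ) := hy
    rw [h2] at h3
    exact absurd h1 (not_le.2 h3)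
  have hExe : ∀ v, IsOpen v → ∀ x ∈ v, e x ∈ Ex v := by
    intro v hv x hx
    have hcl : IsClosed (e '' vᶜ) := he.isClosedEmbedding.isClosedMap _ hv.isClosed_compl
    have h1 : Metric.infEDist (e x) (range e) = 0 := Metric.infEDist_zero_of_mem ⟨x, rfl⟩
    change Metric.infEDist (e x) (range e) < Metric.infEDist (e x) (e '' vᶜ)
    rw [h1, pos_iff_ne_zero]
    intro h
    rw [← Metric.mem_iff_infEDist_zero_of_closed hcl] at h
    obtain ⟨x', hx', h'⟩ := h
    exact hx' (he.injective h' ▸ hx)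
  -- neighbourhoods covered by the extended covers
  have hr : ∀ k, ∃ r > 0, ∀ y, D y ≤ r → ∃ i, y ∈ Ex (C.v k i) := by
    intro k
    obtain ⟨δ, hδ, h⟩ := hcomp.exists_thickening_subset_open
      (isOpen_iUnion fun i => hExo (C.v k i)) (by
        rintro _ ⟨x, rfl⟩
        obtain ⟨i, hi⟩ := C.exists_mem k x
        exact mem_iUnion.2 ⟨i, hExe _ (C.isOpen k i) x hi⟩)
    refine ⟨δ / 2, half_pos hδ, fun y hy => mem_iUnion.1 (h ?_)⟩
    rw [Metric.mem_thickening_iff_infDist_lt hne]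
    change D y < δ
    linarith
  choose r hr0 hr using hr
  let ρ : ℕ → ℝ := fun k => Nat.rec (r 0) (fun k a => min (r (k + 1)) (a / 2)) k
  have hρs : ∀ k, ρ (k + 1) = min (r (k + 1)) (ρ k / 2) := fun k => rfl
  have hρ0 : ∀ k, 0 < ρ k := by
    intro k
    induction k with
    | zero => exact hr0 0
    | succ k ih => rw [hρs]; exact lt_min (hr0 _) (half_pos ih)
  have hρr : ∀ k, ρ k ≤ r k := by
    intro k
    cases k with
    | zero => exact le_rfl
    | succ k => rw [hρs]; exact min_le_left _ _
  have hρh : ∀ k, ρ (k + 1) ≤ ρ k / 2 := fun k => by rw [hρs]; exact min_le_right _ _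
  have hρanti : StrictAnti ρ := strictAnti_nat_of_succ_lt fun k => by linarith [hρh k, hρ0 k]
  have hρpow : ∀ m, ρ m ≤ ρ 0 * (1 / 2) ^ m := by
    intro m
    induction m with
    | zero => simp
    | succ m ih => rw [pow_succ]; linarith [hρh m]
  have hρlim : Filter.Tendsto ρ Filter.atTop (𝓝 0) := by
    refine squeeze_zero (fun m => (hρ0 m).le) hρpow ?_
    have := (tendsto_pow_atTop_nhds_zero_of_lt_one (r := (1 / 2 : ℝ)) (by norm_num)
      (by norm_num)).const_mul (ρ 0)
    simpa using this
  -- barycentric coordinates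
  choose f hf using fun k => PartitionOfUnity.exists_isSubordinate
    (isClosed_le hDc (continuous_const (y := ρ k))) (fun i => Ex (C.v k i))
    (fun i => hExo _) (fun y hy => mem_iUnion.2 (hr k y (le_trans hy (hρr k))))
  let θ : ℕ → ℕ → Y → ℝ := fun k i y => f k i y
  have hθc : ∀ k i, Continuous (θ k i) := fun k i => (f k i).continuous
  have hθ0 : ∀ k y i, 0 ≤ θ k i y := fun k y i => (f k).nonneg i y
  have hθν : ∀ k y i, θ k i y ≠ 0 → ν y ∈ C.v k i := fun k y i h =>
    hExν _ _ (hf k i (subset_tsupport _ h))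
  let A : ℕ → Y → Finset ℕ := fun k y => (Finset.range (C.N k)).filter fun i => ν y ∈ C.v k i
  have hA : ∀ k y i, i ∈ A k y ↔ ν y ∈ C.v k i := fun k y i => by
    simp only [A, Finset.mem_filter, Finset.mem_range, and_iff_right_iff_imp]
    exact C.lt_of_mem k i _
  have hAn : ∀ k y, (A k y).card ≤ n + 1 := fun k y =>
    C.card_le k (ν y) _ fun i hi => (hA k y i).1 hi
  have hθA : ∀ k y i, θ k i y ≠ 0 → i ∈ A k y := fun k y i h => (hA k y i).2 (hθν k y i h)
  have hAN : ∀ k y, ∀ i ∈ A k y, i < C.N k := fun k y i hi => C.lt_of_mem k i _ ((hA k y i).1 hi)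
  have hθsum : ∀ k y, D y ≤ ρ k → ∑ i ∈ Finset.range (C.N k), θ k i y = 1 := by
    intro k y hy
    rw [← (f k).sum_eq_one hy]
    refine (finsum_eq_sum_of_support_subset _ fun i hi => ?_).symm
    exact Finset.mem_coe.2 (Finset.mem_range.2 (hAN k y i (hθA k y i hi)))
  -- the map on the annuli
  let u : ℕ → Y → ℝ := fun k y => (ρ (k + 1) - D y) / (ρ (k + 1) - ρ (k + 2))
  -- The outer radius is ρ (k + 1), so that the partitions of levels k and k + 1 both sum to 1 on
  -- the annulus. There u rises from 0 on the outer edge to 1 on the inner edge.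
  let T : ℕ → Set Y := fun k => {y | ρ (k + 2) ≤ D y ∧ D y ≤ ρ (k + 1)}
  have hTcl : ∀ k, IsClosed (T k) := fun k =>
    (isClosed_le continuous_const hDc).inter (isClosed_le hDc continuous_const)
  let s : ℕ → Y → ℝ := fun k y => max 0 (min 1 (2 * u k y))
  let t : ℕ → Y → ℝ := fun k y => min 1 (2 - 2 * u k y)
  have huc : ∀ k, Continuous (u k) := fun k => (continuous_const.sub hDc).div_const _
  have hst : ∀ k y, s k y = 1 ∨ t k y = 1 := by
    intro k y
    rcases le_total (1 / 2) (u k y) with h | h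
    · left
      simp only [s]
      rw [min_eq_left (by linarith), max_eq_right zero_le_one]
    · right
      simp only [t]
      rw [min_eq_left (by linarith)]
  have hs0 : ∀ k y, 0 ≤ s k y := fun k y => le_max_left _ _
  have hs1 : ∀ k y, s k y ≤ 1 := fun k y => max_le zero_le_one (min_le_left _ _)
  let Θ : ℕ → Y → ℕ × ℕ → ℝ := fun k y =>
    bridge k (C.N (k + 1)) (C.p k) (fun i => θ k i y) (fun i => θ (k + 1) i y) (s k y) (t k y)
  have hΘc : ∀ k, Continuous (Θ k) := fun k => continuous_bridge _ _ _ (hθc k) (hθc (k + 1))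
    (continuous_const.max (continuous_const.min (continuous_const.mul (huc k))))
    (continuous_const.min (continuous_const.sub (continuous_const.mul (huc k))))
  have hΘσ : ∀ k, ∀ y ∈ T k, ∃ σ ⊆ ({k} ×ˢ A k y) ∪ ({k + 1} ×ˢ A (k + 1) y), σ.card ≤ n + 2 ∧
      Θ k y ∈ simplexFace σ := by
    intro k y hy
    refine exists_simplexFace_bridge (hθ0 k y) (hθ0 (k + 1) y) (hs0 k y) (hs1 k y) (hst k y)
      (hθA k y) (hθA (k + 1) y) (hAN k y) (hAN (k + 1) y) (fun i hi => ?_) (hAn k y)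
      (hAn (k + 1) y) (hθsum k y (hy.2.trans (hρanti.antitone (Nat.le_succ k))))
      (hθsum (k + 1) y hy.2)
    exact (hA k y _).2 (C.mem_p k i _ ((hA (k + 1) y i).1 hi))
  have hσν : ∀ k y, ∀ σ ⊆ ({k} ×ˢ A k y) ∪ ({k + 1} ×ˢ A (k + 1) y), ∀ q ∈ σ,
      ν y ∈ C.v q.1 q.2 ∧ k ≤ q.1 := by
    intro k y σ hσ q hq
    have h := hσ hq
    rw [Finset.mem_union, Finset.mem_product, Finset.mem_product, Finset.mem_singleton,
      Finset.mem_singleton] at h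
    rcases h with ⟨h1, h2⟩ | ⟨h1, h2⟩
    · exact ⟨h1 ▸ (hA k y _).1 h2, h1.ge⟩
    · exact ⟨h1 ▸ (hA (k + 1) y _).1 h2, by omega⟩
  let R : ℕ → Y → X := fun k y => F (Θ k y)
  have hRW : ∀ k, ∀ y ∈ T k, R k y ∈ W ∧ dist (R k y) (ν y) ≤ η k := by
    intro k y hy
    obtain ⟨σ, hσ, hc, hm⟩ := hΘσ k y hy
    obtain ⟨-, h⟩ := hF σ hc (ν y) fun q hq => (hσν k y σ hσ q hq).1
    exact ⟨(h _ hm).1, (h _ hm).2 k fun q hq => (hσν k y σ hσ q hq).2⟩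
  have hRc : ∀ k, ContinuousOn (R k) (T k) := by
    intro k
    -- F is known to be continuous only on single closed simplices; finitely many of them, from
    -- levels k and k + 1, receive the whole annulus.
    let S : Finset (Finset (ℕ × ℕ)) :=
      (({k} ×ˢ Finset.range (C.N k)) ∪ ({k + 1} ×ˢ Finset.range (C.N (k + 1)))).powerset.filter
        fun σ => ContinuousOn F (simplexFace σ)
    have h1 : ContinuousOn (R k) (⋃ σ ∈ S, Θ k ⁻¹' simplexFace σ) :=
      continuousOn_biUnion_of_isClosed S
        (fun σ hσ => (Finset.mem_filter.1 hσ).2.comp (hΘc k).continuousOn fun y hy => hy)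
        fun σ _ => (isClosed_simplexFace σ).preimage (hΘc k)
    refine h1.mono fun y hy => ?_
    obtain ⟨σ, hσ, hc, hm⟩ := hΘσ k y hy
    refine mem_iUnion₂.2 ⟨σ, Finset.mem_filter.2 ⟨Finset.mem_powerset.2 (hσ.trans ?_), ?_⟩, hm⟩
    · exact Finset.union_subset_union (Finset.product_subset_product subset_rfl
        (Finset.filter_subset _ _)) (Finset.product_subset_product subset_rfl
        (Finset.filter_subset _ _))
    · exact (hF σ hc (ν y) fun q hq => (hσν k y σ hσ q hq).1).1
  -- On the common edge both formulas reduce to the barycentric point of level k + 1.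
  have hRR : ∀ k y, D y = ρ (k + 2) → R k y = R (k + 1) y := by
    intro k y hy
    have h1 : u k y = 1 := by
      simp only [u, hy]
      exact div_self (sub_pos.2 (hρanti (Nat.lt_succ_self (k + 1)))).ne'
    have h2 : u (k + 1) y = 0 := by
      simp only [u, hy]
      rw [show k + 1 + 1 = k + 2 from rfl, sub_self, zero_div]
    have h3 : s k y = 1 := by simp [s, h1]
    have h4 : t k y = 0 := by simp [t, h1]
    have h5 : s (k + 1) y = 0 := by simp [s, h2]
    have h6 : t (k + 1) y = 1 := by simp [t, h2]
    simp only [R, Θ, h3, h4, h5, h6]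
    congr 1
    funext q
    rw [bridge_one_zero _ _ _ _ (hθ0 (k + 1) y), bridge_zero_one]
  -- the retraction
  let g : Y → X := fun y => if h : ∃ k, y ∈ T k then R (Nat.find h) y else ν y
  have hgT : ∀ k, ∀ y ∈ T k, g y = R k y := by
    intro k y hy
    have h : ∃ k, y ∈ T k := ⟨k, hy⟩
    simp only [g, h, dite_true]
    have hj := Nat.find_spec h
    have hle := Nat.find_min' h hy
    generalize Nat.find h = j at hj hle
    rcases hle.eq_or_lt with rfl | hlt
    · rfl
    · have h1 : ρ (k + 1) ≤ ρ (j + 2) :=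
        hρanti.antitone (show j + 2 ≤ k + 1 by omega)
      have h2 : D y = ρ (j + 2) := le_antisymm (hy.2.trans h1) hj.1
      have h3 : ρ (j + 2) = ρ (k + 1) := le_antisymm (h2 ▸ hy.2) h1
      have h4 : j + 2 = k + 1 := hρanti.injective h3
      obtain rfl : k = j + 1 := by omega
      exact hRR j y h2
  have hνe : ∀ x, ν (e x) = x := fun x => by
    have h1 := hν (e x)
    rw [(hDmem _).2 ⟨x, rfl⟩, he.dist_eq] at h1
    exact (dist_eq_zero.1 h1.symm).symm
  have hgν : ∀ y, D y = 0 → g y = ν y := by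
    intro y hy
    have h : ¬ ∃ k, y ∈ T k := by
      rintro ⟨k, hk, -⟩
      rw [hy] at hk
      exact absurd (hρ0 (k + 2)) (not_lt.2 hk)
    simp only [g, h, dite_false]
  have hfind : ∀ y, 0 < D y → ∀ m, D y < ρ (m + 1) → ∃ k ≥ m, ρ (k + 2) ≤ D y ∧ D y < ρ (k + 1) := by
    intro y hy m hm
    have hex : ∃ k, ρ (k + 2) ≤ D y := by
      obtain ⟨k, hk⟩ := ((hρlim.comp (Filter.tendsto_add_atTop_nat 2)).eventually
        (gt_mem_nhds hy)).exists
      exact ⟨k, hk.le⟩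
    have h1 := Nat.find_spec hex
    have h2 : ∀ {j}, j < Nat.find hex → ¬ ρ (j + 2) ≤ D y := Nat.find_min hex
    generalize Nat.find hex = j at h1 h2
    refine ⟨j, ?_, h1, ?_⟩
    · by_contra! hj
      have := hρanti.antitone (show j + 2 ≤ m + 1 by omega)
      linarith
    · cases j with
      | zero => exact hm.trans_le (hρanti.antitone (show 0 + 1 ≤ m + 1 by omega))
      | succ j => exact not_le.1 (h2 (Nat.lt_succ_self j))
  refine ⟨{y | D y < ρ 1}, isOpen_lt hDc continuous_const, ?_, g, ?_, ?_, ?_⟩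
  · rintro _ ⟨x, rfl⟩
    change D (e x) < ρ 1
    rw [(hDmem _).2 ⟨x, rfl⟩]
    exact hρ0 1
  · intro y₀ hy₀
    refine ContinuousAt.continuousWithinAt ?_
    rcases (hD0 y₀).eq_or_lt with h0 | h0
    · obtain ⟨x, rfl⟩ := (hDmem y₀).1 h0.symm
      rw [Metric.continuousAt_iff']
      intro a ha
      have hη' : ∀ᶠ k in Filter.atTop, η k < a / 2 := hη.eventually (gt_mem_nhds (half_pos ha))
      obtain ⟨m, hm⟩ := Filter.eventually_atTop.1 hη'
      have h1 : ∀ᶠ y in 𝓝 (e x), D y < ρ (m + 1) :=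
        hDc.continuousAt.eventually (gt_mem_nhds (by rw [← h0]; exact hρ0 (m + 1)))
      filter_upwards [h1, Metric.ball_mem_nhds (e x) (show 0 < a / 4 by linarith)] with y hy hyx
      rw [hgν _ h0.symm, hνe]
      -- Continuity at points of X: g y is close to the nearest point `ν y` because the level is
      -- high, and `ν y` is close to x because y is.
      have h2 : dist (g y) (ν y) < a / 2 := by
        rcases (hD0 y).eq_or_lt with h | h
        · rw [hgν y h.symm, dist_self]; exact half_pos ha
        · obtain ⟨k, hk, h3, h4⟩ := hfind y h m hy
          have hyk : y ∈ T k := ⟨h3, h4.le⟩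
          rw [hgT k y hyk]
          exact (hRW k y hyk).2.trans_lt (hm k hk)
      have h3 : dist (ν y) x ≤ 2 * dist y (e x) := by
        rw [← he.dist_eq]
        have h4 : D y ≤ dist y (e x) := Metric.infDist_le_dist_of_mem ⟨x, rfl⟩
        have h5 := dist_triangle_left (e (ν y)) (e x) y
        rw [← hν y] at h5
        linarith
      rw [Metric.mem_ball] at hyx
      have := dist_triangle (g y) (ν y) x
      linarith
    · obtain ⟨k, -, h1, h2⟩ := hfind y₀ h0 0 hy₀
      have hTT : ContinuousOn g (T k ∪ T (k + 1)) :=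
        ContinuousOn.union_of_isClosed ((hRc k).congr (hgT k)) ((hRc (k + 1)).congr (hgT (k + 1)))
          (hTcl k) (hTcl (k + 1))
      refine hTT.continuousAt ?_
      have h3 : ρ (k + 3) < D y₀ := (hρanti (Nat.lt_succ_self (k + 2))).trans_le h1
      filter_upwards [hDc.continuousAt.eventually (gt_mem_nhds h2),
        hDc.continuousAt.eventually (lt_mem_nhds h3)] with y hy hy'
      rcases le_total (ρ (k + 2)) (D y) with h | h
      · exact Or.inl ⟨h, hy.le⟩
      · exact Or.inr ⟨hy'.le, h⟩
  · intro x
    rw [hgν _ ((hDmem _).2 ⟨x, rfl⟩), hνe]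
  · intro y hy hye
    have h0 : 0 < D y := lt_of_le_of_ne (hD0 y) fun h => hye ((hDmem y).1 h.symm)
    obtain ⟨k, -, h1, h2⟩ := hfind y h0 0 hy
    have hyk : y ∈ T k := ⟨h1, h2.le⟩
    rw [hgT k y hyk]
    exact (hRW k y hyk).1

theorem exists_neighborhood_retraction {X Y : Type*} [TopologicalSpace X] [CompactSpace X]
    [TopologicalSpace Y] [MetrizableSpace Y] {e : X → Y} (he : IsClosedEmbedding e) {n : ℕ}
    (hdim : CoveringDimLE n X) {Z : Set X} (hZc : IsClosed Z) (hZn : IsNowhereDense Z)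
    (hLCC : IsLCC n Z) (hLC : IsLC n (Zᶜ : Set X)) :
    ∃ O : Set Y, IsOpen O ∧ range e ⊆ O ∧ ∃ r : C(O, X),
      (∀ (x : X) (hx : e x ∈ O), r ⟨e x, hx⟩ = x) ∧ ∀ y : O, (y : Y) ∉ range e → r y ∉ Z := by
  rcases isEmpty_or_nonempty X with hX | hX
  · refine ⟨∅, isOpen_empty, ?_, ⟨fun y => y.2.elim, continuous_of_const fun y => y.2.elim⟩,
      fun x => (hX.false x).elim, fun y => y.2.elim⟩
    rintro _ ⟨x, -⟩
    exact (hX.false x).elim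
  let _ : MetricSpace Y := metrizableSpaceMetric Y
  -- All hypotheses on X are topological, so its metric may be pulled back from Y to make e an
  -- isometry.
  let _ : MetricSpace X := he.isEmbedding.comapMetricSpace
  have hiso : Isometry e := Isometry.of_dist_eq fun x y => rfl
  have hd : Dense Zᶜ := by
    rw [← interior_eq_empty_iff_dense_compl]
    exact hZc.isNowhereDense_iff.1 hZn
  obtain ⟨O, hO, heO, r, hr, hre, hrW⟩ :=
    exists_retraction_into hiso hd hdim (uniformlyLC_compl hZc hLCC hLC)
  exact ⟨O, hO, heO, ⟨fun y => r y, hr.comp_continuous continuous_subtype_val fun y => y.2⟩,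
    fun x _ => hre x, fun y hy => hrW y y.2 hy⟩

/-! ### From the retraction to Z-sets and absolute retracts -/

theorem isZSet_of_isLCC {X : Type*} [TopologicalSpace X] [CompactSpace X] [MetrizableSpace X]
    {n : ℕ} (hdim : CoveringDimLE n X) {Z : Set X} (hZc : IsClosed Z) (hZn : IsNowhereDense Z)
    (hLCC : IsLCC n Z) (hLC : IsLC n (Zᶜ : Set X)) : IsZSet Z := by
  have he : IsClosedEmbedding fun x : X => (x, (0 : unitInterval)) := by
    refine Continuous.isClosedEmbedding (by fun_prop) fun x y h => ?_
    exact congrArg Prod.fst h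
  obtain ⟨O, hO, heO, r, hr, hrZ⟩ := exists_neighborhood_retraction he hdim hZc hZn hLCC hLC
  have h1 : ∀ᶠ t in 𝓝 (0 : unitInterval), ∀ x ∈ (univ : Set X), (x, t) ∈ O := by
    refine isCompact_univ.eventually_forall_of_forall_eventually fun x _ => ?_
    have : ∀ᶠ z : X × unitInterval in 𝓝 (x, 0), z ∈ O := hO.mem_nhds (heO ⟨x, rfl⟩)
    exact (continuous_swap.tendsto (0, x)).eventually this
  obtain ⟨ε, hε, h2⟩ := Metric.eventually_nhds_iff.1 h1
  -- By compactness of X the slab X × [0, c] lies in O; rescaling it to unit height gives the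
  -- homotopy.
  let c : unitInterval := ⟨min 1 (ε / 2), le_min zero_le_one (half_pos hε).le, min_le_left _ _⟩
  have hc : 0 < c := by
    rw [← Subtype.coe_lt_coe]
    exact lt_min one_pos (half_pos hε)
  have hcO : ∀ (x : X) (t : unitInterval), (x, t * c) ∈ O := by
    intro x t
    refine h2 ?_ x (mem_univ x)
    rw [Subtype.dist_eq, Set.Icc.coe_zero, Real.dist_0_eq_abs, abs_of_nonneg (t * c).2.1]
    have h3 : ((t * c : unitInterval) : ℝ) ≤ c := by
      rw [Set.Icc.coe_mul]
      exact mul_le_of_le_one_left c.2.1 t.2.2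
    have h4 : (c : ℝ) ≤ ε / 2 := min_le_right _ _
    linarith
  refine ⟨hZc, hZn, ⟨fun q => r ⟨(q.1, q.2 * c), hcO _ _⟩, by fun_prop⟩, fun x => ?_,
    fun x t ht => ?_⟩
  · have h3 := hr x (heO ⟨x, rfl⟩)
    simp only [ContinuousMap.coe_mk, zero_mul]
    exact h3
  · refine hrZ _ ?_
    rintro ⟨x', hx'⟩
    have h3 : (0 : unitInterval) = t * c := congrArg Prod.snd hx'
    have h4 := congrArg Subtype.val h3
    rw [Set.Icc.coe_mul, Set.Icc.coe_zero] at h4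
    exact (mul_pos (Subtype.coe_lt_coe.2 ht) (Subtype.coe_lt_coe.2 hc)).ne h4

/-- The homotopy off Z joins the identity to a map factoring through the contractible complement. -/
theorem IsZSet.id_nullhomotopic {X : Type*} [TopologicalSpace X] {Z : Set X} (hZ : IsZSet Z)
    [ContractibleSpace (Zᶜ : Set X)] : (ContinuousMap.id X).Nullhomotopic := by
  obtain ⟨-, -, H, h0, h1⟩ := hZ
  let f : C(X, (Zᶜ : Set X)) := ⟨fun x => ⟨H (x, 1), h1 x 1 one_pos⟩, by fun_prop⟩
  let i : C((Zᶜ : Set X), X) := ⟨Subtype.val, continuous_subtype_val⟩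
  have hf : (ContinuousMap.id X).Homotopic (i.comp f) := ⟨{
    toFun := fun q => H (q.2, q.1)
    continuous_toFun := by fun_prop
    map_zero_left := fun x => h0 x
    map_one_left := fun x => rfl }⟩
  obtain ⟨c, hc⟩ := ((_root_.id_nullhomotopic (Zᶜ : Set X)).comp_left f).comp_right i
  exact ⟨c, hf.trans hc⟩

/-- A Urysohn function drives the contraction of X along the neighbourhood retraction: time 0 on X,
time 1 outside a smaller neighbourhood, where the value is constant and extends to all of Y. -/
theorem IsANR.isAR {X : Type u} [TopologicalSpace X] (hX : IsANR X)
    (hnull : (ContinuousMap.id X).Nullhomotopic) : IsAR X := by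
  classical
  intro Y _ _ _ e he
  obtain ⟨x₀, ⟨K⟩⟩ := hnull
  obtain ⟨O, hO, heO, r, hr⟩ := hX Y e he
  obtain ⟨O', hO', heO', hO'O⟩ := normal_exists_closure_subset he.isClosed_range hO heO
  obtain ⟨l, hl0, hl1, hl⟩ := exists_continuous_zero_one_of_isClosed he.isClosed_range
    hO'.isClosed_compl (disjoint_compl_right_iff_subset.2 heO')
  let r' : Y → X := fun y => if h : y ∈ O then r ⟨y, h⟩ else x₀
  have hr' : ContinuousOn r' O := by
    rw [continuousOn_iff_continuous_domRestrict]
    refine r.continuous.congr fun y => ?_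
    have := y.2
    simp [r', this]
  let R : Y → X := fun y => K (⟨l y, hl y⟩, r' y)
  have hR : Continuous R := by
    rw [← continuousOn_univ, ← union_compl_self (closure O')]
    have hcov : (univ : Set Y) = closure O' ∪ O'ᶜ :=
      (eq_univ_of_forall fun y => (em (y ∈ O')).imp (fun h => subset_closure h) id).symm
    rw [union_compl_self, hcov]
    refine ContinuousOn.union_of_isClosed ?_ ?_ isClosed_closure hO'.isClosed_compl
    · refine K.continuous.comp_continuousOn (ContinuousOn.prodMk ?_ (hr'.mono hO'O))
      exact Continuous.continuousOn (by fun_prop)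
    · refine (continuousOn_const (c := x₀)).congr fun y hy => ?_
      have h1 : (⟨l y, hl y⟩ : unitInterval) = 1 := Subtype.ext (hl1 hy)
      simp only [R, h1, K.apply_one, ContinuousMap.const_apply]
  refine ⟨⟨R, hR⟩, fun x => ?_⟩
  have h0 : (⟨l (e x), hl (e x)⟩ : unitInterval) = 0 := Subtype.ext (hl0 ⟨x, rfl⟩)
  have h1 : e x ∈ O := heO ⟨x, rfl⟩
  simp only [ContinuousMap.coe_mk, R, h0, K.apply_zero, ContinuousMap.id_apply, r', h1, dite_true,
    hr]

theorem theoremB1 (n : ℕ) (X : Type u) [TopologicalSpace X] [CompactSpace X] [MetrizableSpace X]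
    (hdim : CoveringDimLE n X) (Z : Set X) (hZc : IsClosed Z) (hZn : IsNowhereDense Z)
    (hLCC : IsLCC n Z) (hLC : IsLC n (Zᶜ : Set X)) :
    (IsANR X ∧ IsZSet Z) ∧ (ContractibleSpace (Zᶜ : Set X) → IsAR X) := by
  have hANR : IsANR X := fun Y _ _ _ e he => by
    obtain ⟨O, hO, heO, r, hr, -⟩ := exists_neighborhood_retraction he hdim hZc hZn hLCC hLC
    exact ⟨O, hO, heO, r, hr⟩
  have hZ : IsZSet Z := isZSet_of_isLCC hdim hZc hZn hLCC hLC
  exact ⟨⟨hANR, hZ⟩, fun _ => hANR.isAR hZ.id_nullhomotopic⟩
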